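/- **Setting.** Let $(S,\mathcal S,\mu)$ be a $\sigma$-finite measure space with the approximation-by-averaging property: for every $n\in\mathbb N=\{1,2,\dots\}$ there is a finite or countable family $\mathfrak B_n$ of pairwise disjoint measurable sets of positive finite measure such that, for every real Banach space $E$, every $r\in[1,\infty)$ and every $f\in L^r(S;E)$, the averages $f_n=\sum_{B\in\mathfrak B_n}\mathbf 1_B\,\frac1{\mu(B)}\int_B f\,d\mu$ converge to $f$ in $L^r(S;E)$ (the families $\mathfrak B_n$ do not depend on $E$, $r$, $f$). Let $(\Omega,\mathcal A,\mathbb P)$ be a probability space, $q\in[2,\infty)$ and $p\in[1,q]$. An $L^p(S)$-valued random variable $\eta$ is said to lie in $L^p(S;L^q(\Omega))$ if there is an $\mathcal S\otimes\mathcal A$-measurable $\tilde\eta:S\times\Omega\to\mathbb R$ with $\eta(\omega)=\tilde\eta(\cdot,\omega)$ in $L^p(S)$ for almost all $\omega$ such that $s\mapsto\tilde\eta(s,\cdot)$ is in the Bochner space $L^p(S;L^q(\Omega))$; its norm there is that of $s\mapsto\tilde\eta(s,\cdot)$. Let $X\in L^1(\Omega;L^p(S))$ and, for $\ell\in\mathbb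 N$, let $X_\ell\in L^q(\Omega;L^p(S))\cap L^p(S;L^q(\Omega))$; set $X_0:=0$ and $\xi_\ell:=X_\ell-X_{\ell-1}$. Let $\mathcal C_\ell\ge 0$ be the cost of generating one sample of $\xi_\ell$. Suppose there are constants $\alpha,\beta,\gamma,C_\alpha,C_\beta,C_\gamma,c_1,c_2\in(0,\infty)$, $A\in(1,\infty)$ and real numbers $N_\ell$ with $c_1A^\ell\le N_\ell\le c_2A^\ell$ such that, for all $\ell\in\mathbb N$, $$\|\mathbb E[X]-\mathbb E[X_\ell]\|_{L^p(S)}\le C_\alpha N_\ell^{-\alpha},\qquad \|X_\ell-\mathbb E[X_\ell]-(X_{\ell-1}-\mathbb E[X_{\ell-1}])\|_{L^p(S;L^q(\Omega))}\le C_\beta N_\ell^{-\beta},\qquad \mathcal C_\ell\le C_\gamma N_\ell^{\gamma}.$$ For each $\ell\in\mathbb N$ let $(\xi_{\ell,j})_{j\in\mathbb N}\subset L^q(\Omega;L^p(S))\cap L^p(S;L^q(\Omega))$ be a sequence of independent copies of the $L^p(S)$-valued random variable $\xi_\ell$ (no independence between different levels $\ell$ is assumed). **Theorem.** There is a constant $C\in(0,\infty)$,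 depending only on $q,\alpha,\beta,\gamma,C_\alpha,C_\beta,C_\gamma,A,c_1,c_2$, such that for every $\epsilon\in(0,\tfrac12]$ there are $L\in\mathbb N$ and $M_1,\dots,M_L\in\mathbb N$ for which the multilevel Monte Carlo estimator satisfies $$\Bigl\|\mathbb E[X]-\sum_{\ell=1}^L\frac1{M_\ell}\sum_{j=1}^{M_\ell}\xi_{\ell,j}\Bigr\|_{L^q(\Omega;L^p(S))}<\epsilon$$ and its cost is bounded by $$\sum_{\ell=1}^L M_\ell\,\mathcal C_\ell\;\le\; C\cdot\begin{cases}\epsilon^{-\gamma/\alpha}+\epsilon^{-2}&\text{if }\beta>\gamma/2,\\ \epsilon^{-\gamma/\alpha}+\epsilon^{-2}\,|\log_A\epsilon|^3&\text{if }\beta=\gamma/2,\\ \epsilon^{-\gamma/\alpha}+\epsilon^{-2-(\gamma-2\beta)/\alpha}&\text{if }\beta<\gamma/2.\end{cases}$$ -/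

import Mathlib

open MeasureTheory ProbabilityTheory Filter Topology
open scoped ENNReal NNReal

noncomputable section

namespace MLMC

universe u v

/-- `L^p(S)` carries its Borel σ-algebra. -/
instance lpMeasurableSpace {S : Type u} [MeasurableSpace S] {μ : Measure S} {p : ℝ≥0∞}
    [Fact (1 ≤ p)] : MeasurableSpace (Lp ℝ p μ) := borel _

instance lpBorelSpace {S : Type u} [MeasurableSpace S] {μ : Measure S} {p : ℝ≥0∞}
    [Fact (1 ≤ p)] : BorelSpace (Lp ℝ p μ) := ⟨rfl⟩

/-- The average of `f` with respect to a family `𝔅` of pairwise disjoint sets: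
`∑_{B ∈ 𝔅} 1_B • (1/μ(B)) ∫_B f dμ`, a pointwise sum with at most one nonzero term. -/
def averaging {S : Type u} [MeasurableSpace S] (μ : Measure S) {E : Type v}
    [NormedAddCommGroup E] [NormedSpace ℝ E] (𝔅 : Set (Set S)) (f : S → E) : S → E :=
  fun s => ∑' B : 𝔅, (B : Set S).indicator (fun _ => ⨍ x in (B : Set S), f x ∂μ) s

/-- The approximation-by-averaging property of a measure space: there are countable families
`𝔅 n` of pairwise disjoint measurable sets of positive finite measure such that, for all real
Banach spaces `E`, all `r ∈ [1, ∞)` and all `f ∈ L^r(S; E)`, the averages of `f` with respect to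
`𝔅 n` converge to `f` in `L^r(S; E)`. The families do not depend on `E`, `r`, `f`. -/
def ApproxByAveraging {S : Type u} [MeasurableSpace S] (μ : Measure S) : Prop :=
  ∃ 𝔅 : ℕ → Set (Set S),
    (∀ n, (𝔅 n).Countable ∧ (𝔅 n).PairwiseDisjoint id ∧
      ∀ B ∈ 𝔅 n, MeasurableSet B ∧ 0 < μ B ∧ μ B < ∞) ∧
    ∀ (E : Type v) [NormedAddCommGroup E] [NormedSpace ℝ E] [CompleteSpace E]
      (r : ℝ≥0∞), 1 ≤ r → r ≠ ∞ → ∀ f : S → E, MemLp f r μ →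
        Tendsto (fun n => eLpNorm (f - averaging μ (𝔅 n) f) r μ) atTop (𝓝 0)

variable {S : Type u} [MeasurableSpace S] {μ : Measure S}
  {Ω : Type v} [MeasurableSpace Ω] {P : Measure Ω}
  {p q : ℝ≥0∞} [Fact (1 ≤ p)] [Fact (1 ≤ q)]

/-- The `L^p(S)`-valued random variable `η` is represented by `g ∈ L^p(S; L^q(Ω))`: there is a
function `f`, measurable on the product `S × Ω`, such that `η(ω) = f(·, ω)` in `L^p(S)` for almost
all `ω` and `g(s) = f(s, ·)` in `L^q(Ω)` for almost all `s`. -/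
def IsMixedRep (η : Ω → Lp ℝ p μ) (g : Lp (Lp ℝ q P) p μ) : Prop :=
  ∃ f : S × Ω → ℝ, Measurable f ∧
    (∀ᵐ ω ∂P, ∀ᵐ s ∂μ, (η ω : S → ℝ) s = f (s, ω)) ∧
    (∀ᵐ s ∂μ, ∀ᵐ ω ∂P, (g s : Ω → ℝ) ω = f (s, ω))

/-- `η ∈ L^p(S; L^q(Ω))`. -/
def MemMixed (q : ℝ≥0∞) [Fact (1 ≤ q)] (P : Measure Ω) (η : Ω → Lp ℝ p μ) : Prop :=
  ∃ g : Lp (Lp ℝ q P) p μ, IsMixedRep η g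

/-- The norm of `η` in `L^p(S; L^q(Ω))`, with value `∞` if `η` is not in that space. -/
def mixedNorm (q : ℝ≥0∞) [Fact (1 ≤ q)] (P : Measure Ω) (η : Ω → Lp ℝ p μ) : ℝ≥0∞ :=
  ⨅ (g : Lp (Lp ℝ q P) p μ) (_ : IsMixedRep η g), ‖g‖ₑ

/-- The representing element is unique. -/
theorem IsMixedRep.unique [SigmaFinite μ] [SigmaFinite P] {η : Ω → Lp ℝ p μ}
    {g g' : Lp (Lp ℝ q P) p μ} (h : IsMixedRep η g) (h' : IsMixedRep η g') : g = g' := by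
  obtain ⟨f, hf, h1, h2⟩ := h
  obtain ⟨f', hf', h1', h2'⟩ := h'
  have hm : MeasurableSet {z : S × Ω | f z = f' z} := measurableSet_eq_fun hf hf'
  have key : ∀ᵐ ω ∂P, ∀ᵐ s ∂μ, f (s, ω) = f' (s, ω) := by
    filter_upwards [h1, h1'] with ω a b
    filter_upwards [a, b] with s c d
    rw [← c, ← d]
  have key2 : ∀ᵐ s ∂μ, ∀ᵐ ω ∂P, f (s, ω) = f' (s, ω) :=
    (Measure.ae_ae_comm (p := fun s ω => f (s, ω) = f' (s, ω)) hm).2 key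
  apply Lp.ext
  filter_upwards [h2, h2', key2] with s a b c
  apply Lp.ext
  filter_upwards [a, b, c] with ω x y z
  rw [x, y, z]

/-- `mixedNorm` is the Bochner norm of the representing element. -/
theorem IsMixedRep.mixedNorm_eq [SigmaFinite μ] [SigmaFinite P] {η : Ω → Lp ℝ p μ}
    {g : Lp (Lp ℝ q P) p μ} (h : IsMixedRep η g) : mixedNorm q P η = ‖g‖ₑ := by
  refine le_antisymm (iInf₂_le g h) (le_iInf₂ fun g' h' => ?_)
  rw [h.unique h']

/-- The level difference `ξ_ℓ = X_ℓ - X_{ℓ-1}`, used for `ℓ ≥ 1`. -/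
def levelDiff (X : ℕ → Ω → Lp ℝ p μ) (ℓ : ℕ) : Ω → Lp ℝ p μ := fun ω => X ℓ ω - X (ℓ - 1) ω

/-- The multilevel Monte Carlo estimator `∑_{ℓ=1}^L (1/M_ℓ) ∑_j ξ_{ℓ,j}`, where the inner sum is
over the first `M_ℓ` samples on level `ℓ`. -/
def estimator (ξ : ℕ → ℕ → Ω → Lp ℝ p μ) (L : ℕ) (M : ℕ → ℕ) : Ω → Lp ℝ p μ :=
  fun ω => ∑ ℓ ∈ Finset.Icc 1 L, (M ℓ : ℝ)⁻¹ • ∑ j ∈ Finset.range (M ℓ), ξ ℓ j ω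

/-- The cost of the estimator, if one sample on level `ℓ` costs `cost ℓ`. -/
def totalCost (cost : ℕ → ℝ≥0) (L : ℕ) (M : ℕ → ℕ) : ℝ :=
  ∑ ℓ ∈ Finset.Icc 1 L, (M ℓ : ℝ) * (cost ℓ : ℝ)

/-- The complexity bound as a function of the accuracy `ε`. -/
def complexityRate (A α β γ ε : ℝ) : ℝ :=
  if γ / 2 < β then ε ^ (-(γ / α)) + ε ^ (-2 : ℝ)
  else if β = γ / 2 then ε ^ (-(γ / α)) + ε ^ (-2 : ℝ) * |Real.logb A ε| ^ 3
  else ε ^ (-(γ / α)) + ε ^ (-2 - (γ - 2 * β) / α)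

end MLMC

end

/-! With `m ℓ = E[X_ℓ]` and `X_0 = 0`, telescoping splits the error into the bias `E[X] - m L` and,
on each level, the error of a plain Monte Carlo average (`sub_estimator_eq`). The levels are
recombined by the triangle inequality in `L^q(Ω; L^p(S))`, so nothing is needed about their joint
law.

A single level is treated pointwise in `s`. For real centred i.i.d. variables, a second order
expansion of `|·|^q` and induction give `‖∑ Z_j‖_q ≤ K √n ‖Z‖_q` (`exists_eLpNorm_sum_le`). Values
at a point `s` inherit independence and law from the `L^p(S)`-valued variables through a jointly
measurable evaluation (`exists_measurable_eval`). Taking the `L^p(S)` norm in `s`, and Minkowski's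
integral inequality with exponent `q / p ≥ 1`, yields the rate `n^(-1/2)` in `L^q(Ω; L^p(S))`, where
`K` depends on `q` only; the space `L^p(S)` needs no type or martingale property.

What remains is calculus. The bias fixes `A^(αL) ≈ 1/ε`, and sample sizes proportional to
`A^(-(β+γ/2)ℓ)` give a sampling cost of `ε^(-2)` times a product of three geometric sums with
exponents of the sign of `γ/2 - β`. At equality each of the three sums is `L`, whence the cubed
logarithm. -/

namespace MLMC

universe u v

/-! ### Second order expansion of `|·|^q` -/

/-- A companion of Bernoulli's inequality, expanding around `1 + t` instead of `1`. -/
theorem rpow_one_add_le_one_add_mul {t r : ℝ} (ht : -1 < t) (hr : 1 ≤ r) :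
    (1 + t) ^ r ≤ 1 + r * t * (1 + t) ^ (r - 1) := by
  have hx : 0 < 1 + t := by linarith
  -- Bernoulli at `s = -t / (1 + t)`, where `1 + s` is the inverse of `1 + t`; multiplication by `(1
  -- + t) ^ r` then gives the claim.
  have h := one_add_mul_self_le_rpow_one_add (s := -t / (1 + t))
    (by rw [le_div_iff₀ hx]; linarith) hr
  have h1 : 1 + -t / (1 + t) = (1 + t)⁻¹ := by field_simp; ring
  rw [h1, Real.inv_rpow hx.le] at h
  have hpos : 0 < (1 + t) ^ r := Real.rpow_pos_of_pos hx r
  have h2 := mul_le_mul_of_nonneg_right h hpos.le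
  rw [inv_mul_cancel₀ hpos.ne'] at h2
  have h3 : (1 + t) ^ r = (1 + t) ^ (r - 1) * (1 + t) := by
    rw [Real.rpow_sub_one hx.ne']; field_simp
  have h4 : (1 + r * (-t / (1 + t))) * (1 + t) ^ r
      = (1 + t) ^ r - r * t * (1 + t) ^ (r - 1) := by
    rw [h3]; field_simp; ring
  linarith

/-- The companion inequality leaves the remainder `q t ((1 + t)^(q-1) - 1)`, which is of second
order. For `t ≥ 0` the companion inequality at exponent `q - 1` bounds the bracket from above; for
`t < 0` the sign flips and Bernoulli bounds it from below. -/
theorem rpow_one_add_le_of_abs_le {t q : ℝ} (hq : 2 ≤ q) (ht : |t| ≤ 1 / 2) :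
    (1 + t) ^ q ≤ 1 + q * t + q * (q - 1) * 2 ^ (q - 2) * t ^ 2 := by
  obtain ⟨h1, h2⟩ := abs_le.1 ht
  have ha := rpow_one_add_le_one_add_mul (t := t) (r := q) (by linarith) (by linarith)
  have h2q : (1 : ℝ) ≤ 2 ^ (q - 2) := Real.one_le_rpow (by norm_num) (by linarith)
  have hb : t * ((1 + t) ^ (q - 1) - 1) ≤ (q - 1) * 2 ^ (q - 2) * t ^ 2 := by
    rcases le_or_gt 0 t with h0 | h0
    · have hc := rpow_one_add_le_one_add_mul (t := t) (r := q - 1) (by linarith) (by linarith)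
      have hd : (1 + t) ^ (q - 1 - 1) ≤ 2 ^ (q - 2) := by
        rw [show q - 1 - 1 = q - 2 by ring]
        exact Real.rpow_le_rpow (by linarith) (by linarith) (by linarith)
      have he : (q - 1) * t * (1 + t) ^ (q - 1 - 1) ≤ (q - 1) * t * 2 ^ (q - 2) :=
        mul_le_mul_of_nonneg_left hd (mul_nonneg (by linarith) h0)
      calc t * ((1 + t) ^ (q - 1) - 1) ≤ t * ((q - 1) * t * 2 ^ (q - 2)) :=
            mul_le_mul_of_nonneg_left (by linarith) h0
        _ = _ := by ring
    · have hc := one_add_mul_self_le_rpow_one_add (s := t) (by linarith) (p := q - 1)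
        (by linarith)
      calc t * ((1 + t) ^ (q - 1) - 1) ≤ t * ((q - 1) * t) :=
            mul_le_mul_of_nonpos_left (by linarith) h0.le
        _ = (q - 1) * 1 * t ^ 2 := by ring
        _ ≤ _ := by
          apply mul_le_mul_of_nonneg_right _ (sq_nonneg t)
          exact mul_le_mul_of_nonneg_left h2q (by linarith)
  have hc := mul_le_mul_of_nonneg_left hb (show 0 ≤ q by linarith)
  calc (1 + t) ^ q ≤ 1 + q * t * (1 + t) ^ (q - 1) := ha
    _ = 1 + q * t + q * (t * ((1 + t) ^ (q - 1) - 1)) := by ring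
    _ ≤ 1 + q * t + q * ((q - 1) * 2 ^ (q - 2) * t ^ 2) := by linarith
    _ = _ := by ring

/-- Second order expansion of `|·| ^ q` for `q ≥ 2`. -/
theorem exists_abs_add_rpow_le {q : ℝ} (hq : 2 ≤ q) : ∃ C : ℝ, 0 < C ∧ ∀ a b : ℝ,
    |a + b| ^ q ≤ |a| ^ q + q * (|a| ^ (q - 2) * a * b)
      + C * (|a| ^ (q - 2) * b ^ 2 + |b| ^ q) := by
  set C₁ := q * (q - 1) * 2 ^ (q - 2) with hC₁
  set C₂ := (3 : ℝ) ^ q + q * 2 ^ (q - 1) with hC₂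
  have hC₁pos : 0 ≤ C₁ := mul_nonneg (mul_nonneg (by linarith) (by linarith)) (by positivity)
  have hC₂pos : 0 < C₂ := by
    have : 0 ≤ q * (2 : ℝ) ^ (q - 1) := mul_nonneg (by linarith) (by positivity)
    have : 0 < (3 : ℝ) ^ q := by positivity
    linarith
  refine ⟨C₁ + C₂, by linarith, fun a b => ?_⟩
  have hu : 0 ≤ |a| ^ (q - 2) * b ^ 2 := by positivity
  have hv : 0 ≤ |b| ^ q := by positivity
  -- If `|a| ≤ 2|b|`, every term is controlled by `|b|^q`: `3^q` comes from `|a + b| ≤ 3|b|`, and `q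
  -- 2^(q-1)` from the linear term, which may be negative. Otherwise `|a|^q` factors out and `t = b
  -- / a` is small.
  rcases le_or_gt |a| (2 * |b|) with hab | hab
  · have h1 : |a + b| ^ q ≤ 3 ^ q * |b| ^ q := by
      rw [← Real.mul_rpow (by norm_num) (abs_nonneg b)]
      exact Real.rpow_le_rpow (abs_nonneg _) (by linarith [abs_add_le a b]) (by linarith)
    have h2 : -(2 ^ (q - 1) * |b| ^ q) ≤ |a| ^ (q - 2) * a * b := by
      apply neg_le_of_abs_le
      rw [abs_mul, abs_mul, abs_of_nonneg (Real.rpow_nonneg (abs_nonneg a) _)]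
      have h3 : |a| ^ (q - 2) * |a| = |a| ^ (q - 1) := by
        rw [← Real.rpow_add_one' (abs_nonneg a) (by linarith)]; ring_nf
      have h4 : |b| ^ (q - 1) * |b| = |b| ^ q := by
        rw [← Real.rpow_add_one' (abs_nonneg b) (by linarith)]; ring_nf
      rw [h3, ← h4, ← mul_assoc, ← Real.mul_rpow (by norm_num) (abs_nonneg b)]
      gcongr
      linarith
    have h5 := mul_le_mul_of_nonneg_left h2 (show 0 ≤ q by linarith)
    have h6 : 0 ≤ |a| ^ q := by positivity
    have h7 : C₂ * |b| ^ q = 3 ^ q * |b| ^ q + q * (2 ^ (q - 1) * |b| ^ q) := by rw [hC₂]; ring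
    have h8 := mul_nonneg hC₁pos (add_nonneg hu hv)
    have h9 := mul_nonneg hC₂pos.le hu
    linarith
  · have ha : a ≠ 0 := by
      rintro rfl
      rw [abs_zero] at hab
      linarith [abs_nonneg b]
    have hapos : 0 < |a| := abs_pos.2 ha
    have ht : |b / a| ≤ 1 / 2 := by
      rw [abs_div, div_le_iff₀ hapos]; linarith
    have h1 := rpow_one_add_le_of_abs_le hq ht
    have h2 : |a + b| ^ q = |a| ^ q * (1 + b / a) ^ q := by
      have : |a + b| = |a| * (1 + b / a) := by
        have h3 : 0 ≤ 1 + b / a := by linarith [(abs_le.1 ht).1]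
        rw [← abs_of_nonneg h3, ← abs_mul]
        congr 1
        field_simp
      rw [this, Real.mul_rpow hapos.le (by linarith [(abs_le.1 ht).1])]
    have h3 : |a| ^ q = |a| ^ (q - 2) * a ^ 2 := by
      rw [← sq_abs a, ← Real.rpow_natCast, ← Real.rpow_add hapos]
      norm_num
    have h4 := mul_le_mul_of_nonneg_left h1 (Real.rpow_nonneg hapos.le q)
    rw [← h2] at h4
    have h5 : |a| ^ q * (1 + q * (b / a) + C₁ * (b / a) ^ 2)
        = |a| ^ q + q * (|a| ^ (q - 2) * a * b) + C₁ * (|a| ^ (q - 2) * b ^ 2) := by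
      rw [h3]; field_simp
    rw [h5] at h4
    have h6 := mul_nonneg hC₁pos hv
    have h7 := mul_nonneg hC₂pos.le (add_nonneg hu hv)
    linarith

/-! ### Moments of sums of independent centred real variables -/

section Moments

variable {Ω : Type v} [MeasurableSpace Ω] {P : Measure Ω} [IsProbabilityMeasure P]

theorem integrable_abs_rpow {f : Ω → ℝ} {q r : ℝ} (hf : AEStronglyMeasurable f P)
    (hfq : Integrable (fun ω => |f ω| ^ q) P) (hr : 0 ≤ r) (hrq : r ≤ q) :
    Integrable (fun ω => |f ω| ^ r) P := by
  refine Integrable.mono' ((integrable_const (1 : ℝ)).add hfq) ?_ (ae_of_all _ fun ω => ?_)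
  · exact (Real.continuous_rpow_const hr).comp_aestronglyMeasurable
      (continuous_abs.comp_aestronglyMeasurable hf)
  · rw [Real.norm_of_nonneg (by positivity)]
    have hq : 0 ≤ |f ω| ^ q := by positivity
    rcases le_total |f ω| 1 with h | h
    · have := Real.rpow_le_one (abs_nonneg _) h hr
      simp only [Pi.add_apply]; linarith
    · have := Real.rpow_le_rpow_of_exponent_le h hrq
      simp only [Pi.add_apply]; linarith

/-- Jensen for the convex power `q / r`. It reduces the moments of order `q - 2` and `2` in the
induction below to moments of order `q`. -/
theorem integral_abs_rpow_le {f : Ω → ℝ} {q r : ℝ} (hf : AEStronglyMeasurable f P)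
    (hfq : Integrable (fun ω => |f ω| ^ q) P) (hr : 0 ≤ r) (hrq : r ≤ q) (hq : 0 < q) :
    ∫ ω, |f ω| ^ r ∂P ≤ (∫ ω, |f ω| ^ q ∂P) ^ (r / q) := by
  -- The case `r = 0`, which occurs as `q - 2` for `q = 2`, is separate because `q / r` would be the
  -- default value `0`.
  rcases hr.eq_or_lt with rfl | hr0
  · simp
  have hrint := integrable_abs_rpow hf hfq hr hrq
  have key : ∀ ω, (|f ω| ^ r) ^ (q / r) = |f ω| ^ q := fun ω => by
    rw [← Real.rpow_mul (abs_nonneg _), mul_div_cancel₀ _ hr0.ne']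
  have h := (convexOn_rpow (p := q / r) ((one_le_div hr0).2 hrq)).map_integral_le (μ := P)
    (f := fun ω => |f ω| ^ r) (Real.continuous_rpow_const (by positivity)).continuousOn
    isClosed_Ici (ae_of_all _ fun ω => Set.mem_Ici.2 (by positivity)) hrint
    (by simpa [Function.comp_def, key] using hfq)
  simp only [key] at h
  have h0 : 0 ≤ ∫ ω, |f ω| ^ r ∂P := integral_nonneg fun ω => by positivity
  have h2 := Real.rpow_le_rpow (by positivity) h (show 0 ≤ r / q by positivity)
  rwa [← Real.rpow_mul h0, show q / r * (r / q) = 1 by field_simp, Real.rpow_one] at h2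

/-- One step of the moment estimate for sums of independent centred random variables. -/
theorem integral_abs_add_rpow_le {q C : ℝ} (hq : 2 ≤ q)
    (hC : ∀ a b : ℝ, |a + b| ^ q ≤ |a| ^ q + q * (|a| ^ (q - 2) * a * b)
      + C * (|a| ^ (q - 2) * b ^ 2 + |b| ^ q))
    {S Z : Ω → ℝ} (hS : AEStronglyMeasurable S P) (hZ : AEStronglyMeasurable Z P)
    (hSq : Integrable (fun ω => |S ω| ^ q) P) (hZq : Integrable (fun ω => |Z ω| ^ q) P)
    (hind : IndepFun S Z P) (hZ0 : ∫ ω, Z ω ∂P = 0)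
    (hSZ : Integrable (fun ω => |S ω + Z ω| ^ q) P) :
    ∫ ω, |S ω + Z ω| ^ q ∂P ≤ ∫ ω, |S ω| ^ q ∂P
      + C * ((∫ ω, |S ω| ^ (q - 2) ∂P) * (∫ ω, |Z ω| ^ (2 : ℝ) ∂P) + ∫ ω, |Z ω| ^ q ∂P) := by
  have hcont : Continuous fun x : ℝ => |x| ^ (q - 2) :=
    (Real.continuous_rpow_const (by linarith)).comp continuous_abs
  have hS2 := integrable_abs_rpow hS hSq (r := q - 2) (by linarith) (by linarith)
  have hZ2 : Integrable (fun ω => Z ω ^ 2) P := by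
    simpa using integrable_abs_rpow hZ hZq (r := 2) (by norm_num) hq
  have hZ1 : Integrable Z P := by
    have := integrable_abs_rpow hZ hZq (r := 1) (by norm_num) (by linarith)
    simp only [Real.rpow_one] at this
    exact (integrable_norm_iff hZ).1 this
  have hS1 : Integrable (fun ω => |S ω| ^ (q - 2) * S ω) P := by
    refine Integrable.mono' (integrable_abs_rpow hS hSq (r := q - 1) (by linarith) (by linarith))
      ((hcont.comp_aestronglyMeasurable hS).mul hS) (ae_of_all _ fun ω => le_of_eq ?_)
    rw [norm_mul, Real.norm_of_nonneg (by positivity), Real.norm_eq_abs,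
      ← Real.rpow_add_one' (abs_nonneg _) (by linarith)]
    ring_nf
  have hi1 : IndepFun (fun ω => |S ω| ^ (q - 2) * S ω) Z P :=
    hind.comp (φ := fun x => |x| ^ (q - 2) * x) (ψ := id)
      (hcont.mul continuous_id).measurable measurable_id
  have hi2 : IndepFun (fun ω => |S ω| ^ (q - 2)) (fun ω => Z ω ^ 2) P :=
    hind.comp (φ := fun x => |x| ^ (q - 2)) (ψ := fun x => x ^ 2)
      hcont.measurable (continuous_pow 2).measurable
  have hm1 : Integrable (fun ω => |S ω| ^ (q - 2) * S ω * Z ω) P := hi1.integrable_mul hS1 hZ1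
  have hm2 : Integrable (fun ω => |S ω| ^ (q - 2) * Z ω ^ 2) P := hi2.integrable_mul hS2 hZ2
  -- The first order term vanishes by independence and centring; this cancellation is the source of
  -- the growth `n^(q/2)` instead of `n^q`.
  have e1 : ∫ ω, |S ω| ^ (q - 2) * S ω * Z ω ∂P = 0 := by
    rw [hi1.integral_fun_mul_eq_mul_integral hS1.aestronglyMeasurable hZ, hZ0, mul_zero]
  have e2 : ∫ ω, |S ω| ^ (q - 2) * Z ω ^ 2 ∂P
      = (∫ ω, |S ω| ^ (q - 2) ∂P) * (∫ ω, |Z ω| ^ (2 : ℝ) ∂P) := by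
    rw [hi2.integral_fun_mul_eq_mul_integral hS2.aestronglyMeasurable hZ2.aestronglyMeasurable]
    simp
  calc ∫ ω, |S ω + Z ω| ^ q ∂P
      ≤ ∫ ω, (|S ω| ^ q + q * (|S ω| ^ (q - 2) * S ω * Z ω)
          + C * (|S ω| ^ (q - 2) * Z ω ^ 2 + |Z ω| ^ q)) ∂P :=
        integral_mono hSZ ((hSq.add (hm1.const_mul q)).add ((hm2.add hZq).const_mul C))
          fun ω => hC _ _
    _ = _ := by
      have h1 : Integrable (fun ω => |S ω| ^ q + q * (|S ω| ^ (q - 2) * S ω * Z ω)) P :=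
        hSq.add (hm1.const_mul q)
      have h2 : Integrable (fun ω => C * (|S ω| ^ (q - 2) * Z ω ^ 2 + |Z ω| ^ q)) P :=
        (hm2.add hZq).const_mul C
      rw [integral_add h1 h2, integral_add hSq (hm1.const_mul q), integral_const_mul,
        integral_const_mul,
        integral_add hm2 hZq, e1, e2]
      ring

end Moments

/-- With `x = K n` and `b = q / 2`, this closes the induction over the number of summands. It is the
average of two lower bounds for `(x + K)^b`, namely `x^b + K^b` and `x^b + K x^(b-1)`; averaging is
why `K` has to be at least `2 C`. -/
theorem rpow_add_const_ge {x K C b : ℝ} (hx : 0 ≤ x) (hb : 1 ≤ b) (hK1 : 1 ≤ K)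
    (hK : 2 * C ≤ K) : x ^ b + C * (x ^ (b - 1) + 1) ≤ (x + K) ^ b := by
  have h1 : x ^ b + K ^ b ≤ (x + K) ^ b := Real.add_rpow_le_rpow_add hx (by linarith) hb
  have h2 : K ≤ K ^ b := by
    simpa using Real.rpow_le_rpow_of_exponent_le hK1 hb
  have h3 : x ^ b + K * x ^ (b - 1) ≤ (x + K) ^ b := by
    rcases hx.eq_or_lt with rfl | hx0
    -- At `x = 0` the power `x^(b-1)` is `1` for `b = 1` and `0` for `b > 1`.
    · rcases hb.eq_or_lt with rfl | hb1
      · simp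
      · rw [Real.zero_rpow (by linarith), Real.zero_rpow (by linarith)]
        simp only [zero_add, mul_zero]; positivity
    · have e : ∀ y : ℝ, 0 < y → y ^ b = y * y ^ (b - 1) := fun y hy => by
        rw [Real.rpow_sub_one hy.ne']; field_simp
      rw [e x hx0, e (x + K) (by linarith), ← add_mul]
      exact mul_le_mul_of_nonneg_left
        (Real.rpow_le_rpow hx (by linarith) (by linarith)) (by linarith)
  have h4 : 0 ≤ x ^ (b - 1) := by positivity
  nlinarith [mul_le_mul_of_nonneg_right hK h4]

/-- A Marcinkiewicz–Zygmund type inequality for sums of independent centred random variables. -/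
theorem exists_integral_abs_sum_rpow_le {q : ℝ} (hq : 2 ≤ q) : ∃ K : ℝ, 0 < K ∧
    ∀ {Ω : Type v} [MeasurableSpace Ω] {P : Measure Ω} [IsProbabilityMeasure P]
      {Z : ℕ → Ω → ℝ} {σ : ℝ}, 0 ≤ σ → iIndepFun Z P → (∀ j, MemLp (Z j) (ENNReal.ofReal q) P) →
      (∀ j, ∫ ω, Z j ω ∂P = 0) → (∀ j, ∫ ω, |Z j ω| ^ q ∂P ≤ σ ^ q) →
      ∀ n : ℕ, ∫ ω, |∑ j ∈ Finset.range n, Z j ω| ^ q ∂P ≤ (K * n) ^ (q / 2) * σ ^ q := by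
  obtain ⟨C, hC0, hC⟩ := exists_abs_add_rpow_le hq
  have hq0 : 0 < q := by linarith
  refine ⟨max 1 (2 * C), by positivity, ?_⟩
  intro Ω _ P _ Z σ hσ hind hmem hmean hmom n
  set K := max 1 (2 * C) with hKdef
  have hK0 : 0 ≤ K := le_trans zero_le_one (le_max_left _ _)
  have hpow : ∀ {f : Ω → ℝ}, MemLp f (ENNReal.ofReal q) P →
      Integrable (fun ω => |f ω| ^ q) P := fun {f} hf => by
    have := hf.integrable_norm_rpow (by simpa using hq0) ENNReal.ofReal_ne_top
    simpa [ENNReal.toReal_ofReal hq0.le] using this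
  have hsum : ∀ n, MemLp (fun ω => ∑ j ∈ Finset.range n, Z j ω) (ENNReal.ofReal q) P :=
    fun n => memLp_finsetSum _ fun j _ => hmem j
  induction n with
  | zero => simp [Real.zero_rpow hq0.ne', Real.zero_rpow (show q / 2 ≠ 0 by positivity)]
  | succ n ih =>
    have hi : IndepFun (fun ω => ∑ j ∈ Finset.range n, Z j ω) (Z n) P := by
      have := hind.indepFun_finsetSum_of_notMem₀ (fun i => (hmem i).1.aemeasurable)
        (s := Finset.range n) (i := n) (by simp)
      convert this using 1
      ext ω
      simp
    have hstep := integral_abs_add_rpow_le hq hC (hsum n).1 (hmem n).1 (hpow (hsum n))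
      (hpow (hmem n)) hi (hmean n) (by simpa [Finset.sum_range_succ] using hpow (hsum (n + 1)))
    have hJS := integral_abs_rpow_le (hsum n).1 (hpow (hsum n)) (r := q - 2) (by linarith)
      (by linarith) hq0
    have hJZ := integral_abs_rpow_le (hmem n).1 (hpow (hmem n)) (r := 2) (by norm_num) hq hq0
    have hx : 0 ≤ K * n := by positivity
    -- Jensen raises the order from `q - 2` to `q`, where the induction hypothesis applies.
    have hS' : ∫ ω, |∑ j ∈ Finset.range n, Z j ω| ^ (q - 2) ∂P
        ≤ (K * n) ^ (q / 2 - 1) * σ ^ (q - 2) := by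
      refine hJS.trans ((Real.rpow_le_rpow (integral_nonneg fun ω => by positivity) ih
        (div_nonneg (by linarith) hq0.le)).trans_eq ?_)
      rw [Real.mul_rpow (by positivity) (by positivity), ← Real.rpow_mul hx,
        ← Real.rpow_mul hσ]
      congr 2 <;> field_simp
    have hZ' : ∫ ω, |Z n ω| ^ (2 : ℝ) ∂P ≤ σ ^ (2 : ℝ) := by
      refine hJZ.trans ((Real.rpow_le_rpow (integral_nonneg fun ω => by positivity) (hmom n)
        (by positivity)).trans_eq ?_)
      rw [← Real.rpow_mul hσ]
      congr 1; field_simp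
    have hσq : σ ^ (q - 2) * σ ^ (2 : ℝ) = σ ^ q := by
      rw [← Real.rpow_add_of_nonneg hσ (by linarith) (by norm_num)]; ring_nf
    have hprod : (∫ ω, |∑ j ∈ Finset.range n, Z j ω| ^ (q - 2) ∂P)
        * (∫ ω, |Z n ω| ^ (2 : ℝ) ∂P) ≤ (K * n) ^ (q / 2 - 1) * σ ^ q := by
      rw [← hσq, ← mul_assoc]
      exact mul_le_mul hS' hZ' (integral_nonneg fun ω => by positivity) (by positivity)
    have hfin := rpow_add_const_ge hx (show 1 ≤ q / 2 by linarith) (le_max_left 1 (2 * C))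
      (le_max_right 1 (2 * C))
    simp only [Finset.sum_range_succ]
    calc _ ≤ _ := hstep
      _ ≤ (K * n) ^ (q / 2) * σ ^ q + C * ((K * n) ^ (q / 2 - 1) * σ ^ q + σ ^ q) := by
        gcongr
        exact hmom n
      _ = ((K * n) ^ (q / 2) + C * ((K * n) ^ (q / 2 - 1) + 1)) * σ ^ q := by ring
      _ ≤ (K * n + K) ^ (q / 2) * σ ^ q := mul_le_mul_of_nonneg_right hfin (by positivity)
      _ = _ := by push_cast; ring_nf

/-- `L^q` norm form of the moment inequality. -/
theorem exists_eLpNorm_sum_le {q : ℝ≥0∞} (hq : 2 ≤ q) (hq_top : q ≠ ∞) : ∃ K : ℝ, 0 < K ∧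
    ∀ {Ω : Type v} [MeasurableSpace Ω] {P : Measure Ω} [IsProbabilityMeasure P]
      {Z : ℕ → Ω → ℝ} {σ : ℝ≥0∞}, iIndepFun Z P → (∀ j, AEStronglyMeasurable (Z j) P) →
      (∀ j, ∫ ω, Z j ω ∂P = 0) → (∀ j, eLpNorm (Z j) q P ≤ σ) →
      ∀ n : ℕ, 1 ≤ n → eLpNorm (fun ω => ∑ j ∈ Finset.range n, Z j ω) q P
        ≤ ENNReal.ofReal (K * √n) * σ := by
  have hq2 : 2 ≤ q.toReal := by
    simpa using (ENNReal.toReal_le_toReal (by simp) hq_top).2 hq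
  have hq0 : q ≠ 0 := by rintro rfl; simp at hq
  obtain ⟨K, hK0, hK⟩ := exists_integral_abs_sum_rpow_le.{v} hq2
  refine ⟨√K, by positivity, ?_⟩
  intro Ω _ P _ Z σ hind hmeas hmean hmom n hn
  -- For `σ = ∞` the right side is `∞` only because `n ≥ 1`, as `0 * ∞ = 0`.
  rcases eq_or_ne σ ∞ with rfl | hσ
  · have : (0 : ℝ) < n := by exact_mod_cast hn
    rw [ENNReal.mul_top (ENNReal.ofReal_pos.2 (by positivity)).ne']
    exact le_top
  have hmem : ∀ j, MemLp (Z j) q P := fun j => ⟨hmeas j, (hmom j).trans_lt hσ.lt_top⟩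
  have hsum : MemLp (fun ω => ∑ j ∈ Finset.range n, Z j ω) q P :=
    memLp_finsetSum _ fun j _ => hmem j
  have hr0 : 0 < q.toReal := by linarith
  have h := hK (σ := σ.toReal) ENNReal.toReal_nonneg hind
    (by simpa [ENNReal.ofReal_toReal hq_top] using hmem) hmean (fun j => by
      have h1 := hmom j
      rw [(hmem j).eLpNorm_eq_integral_rpow_norm hq0 hq_top,
        ENNReal.ofReal_le_iff_le_toReal hσ] at h1
      have h2 := Real.rpow_le_rpow (by positivity) h1 hr0.le
      rwa [← Real.rpow_mul (integral_nonneg fun ω => by positivity),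
        inv_mul_cancel₀ hr0.ne', Real.rpow_one] at h2) n
  rw [hsum.eLpNorm_eq_integral_rpow_norm hq0 hq_top, ← ENNReal.ofReal_toReal hσ,
    ← ENNReal.ofReal_mul (by positivity)]
  refine ENNReal.ofReal_le_ofReal ((Real.rpow_le_rpow (integral_nonneg fun ω => by positivity) h
    (by positivity)).trans_eq ?_)
  rw [Real.mul_rpow (by positivity) (by positivity), ← Real.rpow_mul (by positivity),
    ← Real.rpow_mul ENNReal.toReal_nonneg, mul_inv_cancel₀ hr0.ne', Real.rpow_one,
    ← Real.sqrt_mul hK0.le, Real.sqrt_eq_rpow]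
  congr 2
  field_simp

/-! ### Minkowski's integral inequality -/

/-- Minkowski's integral inequality, for a left hand side known to be finite. -/
theorem lintegral_lintegral_rpow_le {S : Type u} [MeasurableSpace S] {μ : Measure S} [SFinite μ]
    {Ω : Type v} [MeasurableSpace Ω] {P : Measure Ω} [SFinite P] {r : ℝ} (hr : 1 ≤ r)
    {G : S × Ω → ℝ≥0∞} (hG : Measurable G)
    (hfin : ∫⁻ ω, (∫⁻ s, G (s, ω) ∂μ) ^ r ∂P ≠ ∞) :
    (∫⁻ ω, (∫⁻ s, G (s, ω) ∂μ) ^ r ∂P) ^ (1 / r)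
      ≤ ∫⁻ s, (∫⁻ ω, G (s, ω) ^ r ∂P) ^ (1 / r) ∂μ := by
  rcases hr.eq_or_lt with rfl | hr1
  · simp only [ENNReal.rpow_one, div_one]
    exact (lintegral_lintegral_swap (f := fun ω s => G (s, ω))
      (hG.comp measurable_swap).aemeasurable).le
  have hr0 : 0 < r := by linarith
  set H : Ω → ℝ≥0∞ := fun ω => ∫⁻ s, G (s, ω) ∂μ with hH
  have hHm : Measurable H := hG.lintegral_prod_left'
  set I := ∫⁻ ω, H ω ^ r ∂P with hI
  rcases eq_or_ne I 0 with h0 | h0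
  · rw [h0, ENNReal.zero_rpow_of_pos (by positivity)]
    exact zero_le
  have hconj : (r / (r - 1)).HolderConjugate r :=
    (Real.HolderConjugate.conjExponent hr1).symm
  -- Write `H^r = H^(r-1) H`, insert the definition of `H` in the second factor, exchange the
  -- integrals and apply Hölder in `ω`. Division by `I^(1 - 1/r)` is legitimate since `I` is neither
  -- `0` nor `∞`.
  have key : I ≤ I ^ (1 - 1 / r) * ∫⁻ s, (∫⁻ ω, G (s, ω) ^ r ∂P) ^ (1 / r) ∂μ := by
    calc I = ∫⁻ ω, ∫⁻ s, H ω ^ (r - 1) * G (s, ω) ∂μ ∂P := by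
          rw [hI]
          refine lintegral_congr fun ω => ?_
          rw [lintegral_const_mul (f := fun s => G (s, ω)) _ (hG.comp measurable_prodMk_right)]
          change H ω ^ r = H ω ^ (r - 1) * H ω
          conv_rhs => rw [← ENNReal.rpow_one (H ω), ← ENNReal.rpow_mul, one_mul]
          rw [← ENNReal.rpow_add_of_nonneg _ _ (by linarith) zero_le_one, sub_add_cancel]
      _ = ∫⁻ s, ∫⁻ ω, H ω ^ (r - 1) * G (s, ω) ∂P ∂μ := by
          refine lintegral_lintegral_swap (Measurable.aemeasurable ?_)
          exact ((hHm.comp measurable_fst).pow_const _).mul (hG.comp measurable_swap)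
      _ ≤ ∫⁻ s, I ^ (1 - 1 / r) * (∫⁻ ω, G (s, ω) ^ r ∂P) ^ (1 / r) ∂μ := by
          refine lintegral_mono fun s => ?_
          have h := ENNReal.lintegral_mul_le_Lp_mul_Lq P hconj
            (f := fun ω => H ω ^ (r - 1)) (g := fun ω => G (s, ω))
            (hHm.pow_const _).aemeasurable (hG.comp measurable_prodMk_left).aemeasurable
          refine h.trans_eq ?_
          congr 1
          have e1 : ∀ ω, (H ω ^ (r - 1)) ^ (r / (r - 1)) = H ω ^ r := fun ω => by
            rw [← ENNReal.rpow_mul, mul_div_cancel₀ _ (by linarith : r - 1 ≠ 0)]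
          simp only [e1]
          rw [← hI]
          congr 1
          have : r - 1 ≠ 0 := by linarith
          field_simp
      _ = _ := by
          rw [lintegral_const_mul]
          exact ((hG.pow_const r).lintegral_prod_right').pow_const _
  have hI1 : I ^ (1 - 1 / r) ≠ 0 := by
    simp [ENNReal.rpow_eq_zero_iff, h0, hfin]
  have hI2 : I ^ (1 - 1 / r) ≠ ∞ := by
    simp [ENNReal.rpow_eq_top_iff, h0, hfin]
  have e : I = I ^ (1 - 1 / r) * I ^ (1 / r) := by
    rw [← ENNReal.rpow_add _ _ h0 hfin, sub_add_cancel, ENNReal.rpow_one]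
  nth_rw 1 [e] at key
  exact (ENNReal.mul_le_mul_iff_right hI1 hI2).1 key

/-! ### Pointwise values of `L^p(S)`-valued random variables -/

/-- `L^p(S)` has a jointly measurable evaluation map on every separable subset. Pointwise values of
independent copies are therefore independent copies, without any approximation by averages. -/
theorem exists_measurable_eval {S : Type u} [MeasurableSpace S] {μ : Measure S} {p : ℝ≥0∞}
    [hp : Fact (1 ≤ p)] {T : Set (Lp ℝ p μ)} (hT : TopologicalSpace.IsSeparable T) :
    ∃ e : S × Lp ℝ p μ → ℝ, Measurable e ∧ ∀ x ∈ T, ∀ᵐ s ∂μ, (x : S → ℝ) s = e (s, x) := by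
  classical
  rcases T.eq_empty_or_nonempty with rfl | hne
  · exact ⟨fun _ => 0, measurable_const, by simp⟩
  obtain ⟨c, hc, hTc⟩ := hT
  have hcne : c.Nonempty := by
    rw [← closure_nonempty_iff]; exact hne.mono hTc
  obtain ⟨d, rfl⟩ := hc.exists_eq_range hcne
  -- The second alternative makes the search succeed for every `x`, so the first index of a
  -- `2^(-n)`-approximation in `d` becomes a Borel function on all of `L^p(S)`.
  have hex : ∀ (n : ℕ) (x : Lp ℝ p μ), ∃ k, dist x (d k) < (1 / 2 : ℝ) ^ n ∨
      x ∉ closure (Set.range d) := fun n x => by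
    by_cases hx : x ∈ closure (Set.range d)
    · obtain ⟨_, ⟨k, rfl⟩, hk⟩ := Metric.mem_closure_iff.1 hx ((1 / 2 : ℝ) ^ n) (by positivity)
      exact ⟨k, Or.inl hk⟩
    · exact ⟨0, Or.inr hx⟩
  have hkm : ∀ n, Measurable fun x => Nat.find (hex n x) := fun n =>
    measurable_find _ fun k =>
      (isOpen_lt (continuous_id.dist continuous_const) continuous_const).measurableSet.union
        isClosed_closure.measurableSet.compl
  set f : ℕ → S × Lp ℝ p μ → ℝ := fun n z => (d (Nat.find (hex n z.2)) : S → ℝ) z.1 with hf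
  have hfm : ∀ n, Measurable (f n) := fun n => by
    have h1 : Measurable fun z : ℕ × S => (d z.1 : S → ℝ) z.2 :=
      measurable_from_prod_countable_right fun k => (Lp.stronglyMeasurable (d k)).measurable
    exact h1.comp (((hkm n).comp measurable_snd).prodMk measurable_fst)
  -- The upper limit is measurable whether or not the sequence converges, and equals the limit where
  -- it does.
  refine ⟨fun z => limsup (fun n => f n z) atTop, Measurable.limsup hfm, fun x hx => ?_⟩
  have hx' := hTc hx
  have hclose : ∀ n, dist x (d (Nat.find (hex n x))) < (1 / 2 : ℝ) ^ n := fun n =>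
    (Nat.find_spec (hex n x)).resolve_right (not_not.2 hx')
  -- The `L^p` errors are geometrically small, hence summable, so the whole sequence converges
  -- almost everywhere.
  have hsum : ∀ᵐ s ∂μ, Summable fun n =>
      ‖((d (Nat.find (hex n x)) - x : Lp ℝ p μ) : S → ℝ) s‖ := by
    refine summable_norm_of_tsum_eLpNorm_ne_top hp.out
      (fun n => Lp.aestronglyMeasurable _) ?_
    have hle : ∀ n, eLpNorm (d (Nat.find (hex n x)) - x : Lp ℝ p μ) p μ
        ≤ ENNReal.ofReal ((1 / 2 : ℝ) ^ n) := fun n => by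
      rw [← Lp.enorm_def, ← ofReal_norm, ← dist_eq_norm, dist_comm]
      exact ENNReal.ofReal_le_ofReal (hclose n).le
    refine ne_top_of_le_ne_top ?_ (ENNReal.tsum_le_tsum hle)
    rw [← ENNReal.ofReal_tsum_of_nonneg (fun n => by positivity) summable_geometric_two]
    exact ENNReal.ofReal_ne_top
  have hsub : ∀ᵐ s ∂μ, ∀ n, ((d (Nat.find (hex n x)) - x : Lp ℝ p μ) : S → ℝ) s
      = (d (Nat.find (hex n x)) : S → ℝ) s - (x : S → ℝ) s :=
    ae_all_iff.2 fun n => Lp.coeFn_sub _ _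
  filter_upwards [hsum, hsub] with s h1 h2
  have h3 := tendsto_zero_iff_norm_tendsto_zero.2 h1.tendsto_atTop_zero
  simp only [h2] at h3
  have h4 : Tendsto (fun n => f n (s, x)) atTop (𝓝 ((x : S → ℝ) s)) := by
    simpa [hf] using h3.add_const ((x : S → ℝ) s)
  exact h4.limsup_eq.symm

section Mixed

variable {S : Type u} [MeasurableSpace S] {μ : Measure S} {Ω : Type v} [MeasurableSpace Ω]
  {P : Measure Ω} {p q : ℝ≥0∞} [Fact (1 ≤ p)]

/-- The norm of `L^q(Ω; L^p(S))` is dominated by that of `L^p(S; L^q(Ω))` if `p ≤ q`. -/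
theorem eLpNorm_le_eLpNorm_eLpNorm [SFinite μ] [SFinite P] (hpq : p ≤ q) (hq_top : q ≠ ∞)
    {U : Ω → Lp ℝ p μ} (hU : MemLp U q P) {G : S × Ω → ℝ} (hG : Measurable G)
    (hUG : ∀ᵐ ω ∂P, ∀ᵐ s ∂μ, (U ω : S → ℝ) s = G (s, ω)) :
    eLpNorm U q P ≤ eLpNorm (fun s => eLpNorm (fun ω => G (s, ω)) q P) p μ := by
  have hp1 : 1 ≤ p := Fact.out
  have hp0 : p ≠ 0 := (zero_lt_one.trans_le hp1).ne'
  have hq0 : q ≠ 0 := ((zero_lt_one.trans_le hp1).trans_le hpq).ne'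
  have hp_top : p ≠ ∞ := ne_top_of_le_ne_top hq_top hpq
  have hpr : 0 < p.toReal := ENNReal.toReal_pos hp0 hp_top
  have hqr : 0 < q.toReal := ENNReal.toReal_pos hq0 hq_top
  -- Minkowski is applied to `|G|^p` with exponent `r = q / p`; `p ≤ q` is exactly `1 ≤ r`.
  set r := q.toReal / p.toReal with hr
  have hr1 : 1 ≤ r := (one_le_div hpr).2 ((ENNReal.toReal_le_toReal hp_top hq_top).2 hpq)
  have hnorm : ∀ᵐ ω ∂P, ‖U ω‖ₑ ^ q.toReal = (∫⁻ s, ‖G (s, ω)‖ₑ ^ p.toReal ∂μ) ^ r := by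
    filter_upwards [hUG] with ω hω
    rw [Lp.enorm_def, eLpNorm_congr_ae (g := fun s => G (s, ω)) hω,
      eLpNorm_eq_lintegral_rpow_enorm_toReal hp0 hp_top, ← ENNReal.rpow_mul]
    congr 1
    rw [hr]; ring
  have hI := lintegral_congr_ae hnorm
  have hfin : ∫⁻ ω, (∫⁻ s, ‖G (s, ω)‖ₑ ^ p.toReal ∂μ) ^ r ∂P ≠ ∞ := by
    rw [← hI]
    exact (lintegral_rpow_enorm_lt_top_of_eLpNorm_lt_top hq0 hq_top hU.2).ne
  have key := lintegral_lintegral_rpow_le (μ := μ) (P := P) hr1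
    (G := fun z => ‖G z‖ₑ ^ p.toReal) (hG.enorm.pow_const _) hfin
  have hR : ∀ s, (∫⁻ ω, (‖G (s, ω)‖ₑ ^ p.toReal) ^ r ∂P) ^ (1 / r)
      = ‖eLpNorm (fun ω => G (s, ω)) q P‖ₑ ^ p.toReal := fun s => by
    rw [enorm_eq_self, eLpNorm_eq_lintegral_rpow_enorm_toReal hq0 hq_top, ← ENNReal.rpow_mul]
    congr 1
    · refine lintegral_congr fun ω => ?_
      rw [← ENNReal.rpow_mul]
      congr 1
      rw [hr]; field_simp
    · rw [hr]; field_simp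
  simp only [hR] at key
  rw [eLpNorm_eq_lintegral_rpow_enorm_toReal hq0 hq_top,
    eLpNorm_eq_lintegral_rpow_enorm_toReal hp0 hp_top, hI]
  have hexp : 1 / q.toReal = 1 / r * (1 / p.toReal) := by rw [hr]; field_simp
  rw [hexp, ENNReal.rpow_mul]
  exact ENNReal.rpow_le_rpow key (by positivity)

/-- Integration over a set of finite measure is a continuous functional on `L^p`. -/
theorem exists_clm_eq_setIntegral {B : Set S} (hB : MeasurableSet B) (hμB : μ B ≠ ∞) :
    ∃ Λ : Lp ℝ p μ →L[ℝ] ℝ, ∀ x, Λ x = ∫ s in B, (x : S → ℝ) s ∂μ := by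
  have : p.conjExponent.HolderConjugate p := .symm
  have : Fact (1 ≤ p.conjExponent) := ⟨by simp [ENNReal.conjExponent]⟩
  refine ⟨(ContinuousLinearMap.mul ℝ ℝ).lpPairing μ p.conjExponent p
    (indicatorConstLp p.conjExponent hB hμB 1), fun x => ?_⟩
  rw [ContinuousLinearMap.lpPairing_eq_integral, ← integral_indicator hB]
  refine integral_congr_ae ?_
  filter_upwards [indicatorConstLp_coeFn (p := p.conjExponent) (hs := hB) (hμs := hμB)
    (c := (1 : ℝ))] with s hs
  rw [hs]
  by_cases h : s ∈ B <;> simp [h]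

/-- The Bochner expectation of an `L^p(S)`-valued random variable is the pointwise one. -/
theorem ae_integral_eq [SigmaFinite μ] [SigmaFinite P] {η : Ω → Lp ℝ p μ} (hη : Integrable η P)
    {F : S × Ω → ℝ} (hF : Measurable F)
    (hηF : ∀ᵐ ω ∂P, ∀ᵐ s ∂μ, (η ω : S → ℝ) s = F (s, ω)) :
    ∀ᵐ s ∂μ, ∫ ω, F (s, ω) ∂P = ((∫ ω, η ω ∂P : Lp ℝ p μ) : S → ℝ) s := by
  have hLp : ∀ (x : Lp ℝ p μ) (B : Set S), μ B < ∞ → IntegrableOn (x : S → ℝ) B μ :=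
    fun x B hμB => by
      have : IsFiniteMeasure (μ.restrict B) := ⟨by simpa using hμB⟩
      exact ((Lp.memLp x).restrict B).integrable Fact.out
  -- Integrating `|F(·, ω)|` over `B` is the functional `Λ` evaluated at `|η ω|`, hence at most `‖Λ‖
  -- ‖η ω‖`, which is integrable in `ω`.
  have hint : ∀ B, MeasurableSet B → μ B < ∞ → Integrable F ((μ.restrict B).prod P) := by
    intro B hB hμB
    obtain ⟨Λ, hΛ⟩ := exists_clm_eq_setIntegral (p := p) hB hμB.ne
    rw [integrable_prod_iff' hF.aestronglyMeasurable]
    constructor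
    · filter_upwards [hηF] with ω hω
      exact (hLp (η ω) B hμB).congr (ae_restrict_of_ae hω)
    · refine Integrable.mono' (hη.norm.const_mul ‖Λ‖) ?_ ?_
      · exact (hF.norm.comp measurable_swap).stronglyMeasurable.integral_prod_right'
          |>.aestronglyMeasurable
      · filter_upwards [hηF] with ω hω
        have h1 : ∫ s in B, ‖F (s, ω)‖ ∂μ = Λ |η ω| := by
          rw [hΛ]
          refine integral_congr_ae (ae_restrict_of_ae ?_)
          filter_upwards [hω, Lp.coeFn_abs (η ω)] with s h2 h3
          rw [h3, h2, Real.norm_eq_abs]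
        rw [h1]
        simpa [norm_abs_eq_norm] using Λ.le_opNorm |η ω|
  refine ae_eq_of_forall_setIntegral_eq_of_sigmaFinite
    (fun B hB hμB => (hint B hB hμB).integral_prod_left) (fun B _ hμB => hLp _ B hμB) ?_
  -- Over a set of finite measure the two sides agree because `Λ` commutes with the Bochner integral
  -- and Fubini applies; by σ-finiteness such sets determine the function.
  intro B hB hμB
  obtain ⟨Λ, hΛ⟩ := exists_clm_eq_setIntegral (p := p) hB hμB.ne
  rw [← hΛ, ← Λ.integral_comp_comm hη,
    integral_integral_swap (f := fun s ω => F (s, ω)) (hint B hB hμB)]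
  refine integral_congr_ae ?_
  filter_upwards [hηF] with ω hω
  rw [hΛ]
  exact integral_congr_ae (ae_restrict_of_ae (hω.mono fun s hs => hs.symm))

end Mixed

/-! ### Monte Carlo error on a single level -/

/-- The Monte Carlo error in `L^q(Ω; L^p(S))`, bounded by the norm in `L^p(S; L^q(Ω))`. -/
theorem exists_eLpNorm_integral_sub_average_le {q : ℝ≥0∞} [Fact (1 ≤ q)] (hq : 2 ≤ q)
    (hq_top : q ≠ ∞) : ∃ K : ℝ, 0 < K ∧
    ∀ {S : Type u} [MeasurableSpace S] {μ : Measure S} [SigmaFinite μ]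
      {Ω : Type v} [MeasurableSpace Ω] {P : Measure Ω} [IsProbabilityMeasure P]
      {p : ℝ≥0∞} [Fact (1 ≤ p)], p ≤ q →
      ∀ {η : Ω → Lp ℝ p μ}, MemLp η q P → ∀ {b : ℝ},
      mixedNorm q P (fun ω => η ω - ∫ ω', η ω' ∂P) ≤ ENNReal.ofReal b →
      ∀ {ξ : ℕ → Ω → Lp ℝ p μ}, (∀ j, MemLp (ξ j) q P) → iIndepFun ξ P →
      (∀ j, IdentDistrib (ξ j) η P P) → ∀ n : ℕ, 1 ≤ n →
      eLpNorm (fun ω => (∫ ω', η ω' ∂P) - (n : ℝ)⁻¹ • ∑ j ∈ Finset.range n, ξ j ω) q P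
        ≤ ENNReal.ofReal (K * (√n)⁻¹ * b) := by
  obtain ⟨K, hK0, hK⟩ := exists_eLpNorm_sum_le.{v} hq hq_top
  refine ⟨K, hK0, ?_⟩
  intro S _ μ _ Ω _ P _ p _ hpq η hη b hb ξ hξ hind hid n hn
  have hq1 : 1 ≤ q := Fact.out
  set m := ∫ ω, η ω ∂P with hm
  have hηint : Integrable η P := hη.integrable hq1
  -- the element of `L^p(S; L^q(Ω))` representing the centred variable
  obtain ⟨g, hg⟩ : ∃ g : Lp (Lp ℝ q P) p μ, IsMixedRep (fun ω => η ω - m) g := by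
    -- Without a representative, `mixedNorm` is an infimum over an empty family, that is `∞`,
    -- against the finite bound.
    by_contra hcon
    have : mixedNorm q P (fun ω => η ω - m) = ∞ := by
      simp only [mixedNorm, iInf_eq_top]
      exact fun g hg => (hcon ⟨g, hg⟩).elim
    rw [this] at hb
    exact absurd hb (by simp)
  rw [hg.mixedNorm_eq] at hb
  obtain ⟨f, hf, hηf, hgf⟩ := hg
  -- a measurable evaluation map on the ranges of the random variables involved
  obtain ⟨T₀, hT₀, hηT⟩ := hη.1.isSeparable_ae_range
  choose T hT hξT using fun j => (hξ j).1.isSeparable_ae_range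
  obtain ⟨e, he, heval⟩ := exists_measurable_eval
    (hT₀.union (TopologicalSpace.IsSeparable.iUnion hT))
  set m' : S → ℝ := (m : S → ℝ)
  have hm' : Measurable m' := (Lp.stronglyMeasurable m).measurable
  set η' := hη.1.mk η with hη'
  have hη'm : Measurable η' := hη.1.stronglyMeasurable_mk.measurable
  have hηae : η =ᵐ[P] η' := hη.1.ae_eq_mk
  set ξ' : ℕ → Ω → Lp ℝ p μ := fun j => (hξ j).1.mk (ξ j) with hξ'
  have hξ'm : ∀ j, Measurable (ξ' j) := fun j => (hξ j).1.stronglyMeasurable_mk.measurable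
  have hξae : ∀ j, ξ j =ᵐ[P] ξ' j := fun j => (hξ j).1.ae_eq_mk
  have hes : ∀ s, Measurable fun x => e (s, x) := fun s => he.comp measurable_prodMk_left
  have hFm : ∀ {ζ : Ω → Lp ℝ p μ}, Measurable ζ → Measurable fun z : S × Ω => e (z.1, ζ z.2) :=
    fun hζ => he.comp (measurable_fst.prodMk (hζ.comp measurable_snd))
  have hηe : ∀ᵐ ω ∂P, ∀ᵐ s ∂μ, (η ω : S → ℝ) s = e (s, η' ω) := by
    filter_upwards [hηT, hηae] with ω h1 h2
    rw [← h2]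
    exact heval _ (Or.inl h1)
  have hξe : ∀ j, ∀ᵐ ω ∂P, ∀ᵐ s ∂μ, (ξ j ω : S → ℝ) s = e (s, ξ' j ω) := fun j => by
    filter_upwards [hξT j, hξae j] with ω h1 h2
    rw [← h2]
    exact heval _ (Or.inr (Set.mem_iUnion.2 ⟨j, h1⟩))
  -- the centred pointwise variables
  have hgF : ∀ᵐ s ∂μ, ∀ᵐ ω ∂P, e (s, η' ω) - m' s = (g s : Ω → ℝ) ω := by
    have h1 : ∀ᵐ ω ∂P, ∀ᵐ s ∂μ, e (s, η' ω) - m' s = f (s, ω) := by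
      filter_upwards [hηe, hηf] with ω h1 h2
      filter_upwards [h1, h2, Lp.coeFn_sub (η ω) m] with s h3 h4 h5
      rw [← h4, h5, Pi.sub_apply, h3]
    have h2 := (Measure.ae_ae_comm (μ := μ) (ν := P)
      (p := fun s ω => e (s, η' ω) - m' s = f (s, ω))
      (measurableSet_eq_fun ((hFm hη'm).sub (hm'.comp measurable_fst)) hf)).2 h1
    filter_upwards [h2, hgf] with s h3 h4
    filter_upwards [h3, h4] with ω h5 h6
    rw [h5, h6]
  have hmean := ae_integral_eq hηint (hFm hη'm) hηe
  have hsum : ∀ᵐ s ∂μ, eLpNorm (fun ω => ∑ j ∈ Finset.range n, (e (s, ξ' j ω) - m' s)) q P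
      ≤ ENNReal.ofReal (K * √n) * ‖g s‖ₑ := by
    filter_upwards [hgF, hmean] with s h1 h2
    -- For fixed `s` this is one measurable function on `L^p(S)`, applied to all samples;
    -- independence and equality of laws pass through it.
    have hφ : Measurable fun x => e (s, x) - m' s := (hes s).sub_const _
    have hid' : ∀ j, IdentDistrib (fun ω => e (s, ξ' j ω) - m' s)
        (fun ω => e (s, η' ω) - m' s) P P := fun j =>
      (((IdentDistrib.of_ae_eq (hξ j).1.aemeasurable (hξae j)).symm.trans (hid j)).trans
        (IdentDistrib.of_ae_eq hη.1.aemeasurable hηae)).comp hφ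
    have hmem : MemLp (fun ω => e (s, η' ω) - m' s) q P :=
      (memLp_congr_ae h1).2 (Lp.memLp (g s))
    have hnorm : eLpNorm (fun ω => e (s, η' ω) - m' s) q P = ‖g s‖ₑ := by
      rw [Lp.enorm_def]; exact eLpNorm_congr_ae h1
    have hzero : ∫ ω, (e (s, η' ω) - m' s) ∂P = 0 := by
      have hi : Integrable (fun ω => e (s, η' ω)) P := by
        refine ((hmem.integrable hq1).add (integrable_const (m' s))).congr (ae_of_all _ fun ω => ?_)
        exact sub_add_cancel _ _
      rw [integral_sub hi (integrable_const _), h2]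
      simp [m', hm]
    refine hK (Z := fun j ω => e (s, ξ' j ω) - m' s) ?_ ?_ ?_ ?_ n hn
    · exact (hind.congr hξae).comp (fun _ x => e (s, x) - m' s) fun _ => hφ
    · exact fun j => (hφ.comp (hξ'm j)).aestronglyMeasurable
    · exact fun j => (hid' j).integral_eq.trans hzero
    · exact fun j => (((hid' j).eLpNorm_eq q).trans hnorm).le
  set U : Ω → Lp ℝ p μ := fun ω => ∑ j ∈ Finset.range n, (ξ j ω - m) with hU
  have hUmem : MemLp U q P := memLp_finsetSum _ fun j _ => (hξ j).sub (memLp_const m)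
  have hUG : ∀ᵐ ω ∂P, ∀ᵐ s ∂μ,
      (U ω : S → ℝ) s = ∑ j ∈ Finset.range n, (e (s, ξ' j ω) - m' s) := by
    filter_upwards [ae_all_iff.2 hξe] with ω h1
    have h2 : ∀ᵐ s ∂μ, ∀ j, ((ξ j ω - m : Lp ℝ p μ) : S → ℝ) s = e (s, ξ' j ω) - m' s := by
      refine ae_all_iff.2 fun j => ?_
      filter_upwards [h1 j, Lp.coeFn_sub (ξ j ω) m] with s h3 h4
      rw [h4, Pi.sub_apply, h3]
    filter_upwards [h2, Lp.coeFn_finsetSum (Finset.range n) fun j => ξ j ω - m] with s h3 h4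
    rw [hU, h4, Finset.sum_apply]
    exact Finset.sum_congr rfl fun j _ => h3 j
  have hUle : eLpNorm U q P ≤ ENNReal.ofReal (K * √n) * ENNReal.ofReal b := by
    refine (eLpNorm_le_eLpNorm_eLpNorm hpq hq_top hUmem
      (G := fun z => ∑ j ∈ Finset.range n, (e (z.1, ξ' j z.2) - m' z.1)) ?_ hUG).trans ?_
    · exact Finset.measurable_fun_sum _ fun j _ =>
        (hFm (hξ'm j)).sub (hm'.comp measurable_fst)
    · refine le_trans ?_ (mul_le_mul_right hb _)
      rw [Lp.enorm_def]
      exact eLpNorm_le_mul_eLpNorm_of_ae_le_mul' (c := (K * √n).toNNReal) hsum p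
  have hn0 : (0 : ℝ) < n := by exact_mod_cast hn
  have hEq : (fun ω => m - (n : ℝ)⁻¹ • ∑ j ∈ Finset.range n, ξ j ω) = (-(n : ℝ)⁻¹) • U := by
    ext1 ω
    rw [Pi.smul_apply, hU]
    simp only [Finset.sum_sub_distrib, Finset.sum_const, Finset.card_range]
    rw [← Nat.cast_smul_eq_nsmul ℝ, smul_sub, smul_smul, neg_mul, inv_mul_cancel₀ hn0.ne']
    simp only [neg_smul, one_smul]
    abel
  rw [hEq, eLpNorm_const_smul]
  refine (mul_le_mul_right hUle _).trans_eq ?_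
  rw [← ofReal_norm, norm_neg, norm_inv, Real.norm_of_nonneg hn0.le,
    ← ENNReal.ofReal_mul (by positivity), ← ENNReal.ofReal_mul (by positivity)]
  congr 1
  have hs : (n : ℝ) = √n * √n := (Real.mul_self_sqrt hn0.le).symm
  have hs0 : √(n : ℝ) ≠ 0 := (Real.sqrt_pos.2 hn0).ne'
  nth_rw 1 [hs]
  field_simp

/-! ### Choice of parameters and count of the cost -/

section Parameters

variable {A : ℝ}

theorem exists_sum_rpow_le_mul_rpow (hA : 1 < A) {θ : ℝ} (hθ : 0 < θ) : ∃ G : ℝ, 0 < G ∧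
    ∀ L : ℕ, ∑ ℓ ∈ Finset.Icc 1 L, A ^ (θ * ℓ) ≤ G * A ^ (θ * L) := by
  have hA0 : 0 < A := by linarith
  have h1 : 1 < A ^ θ := Real.one_lt_rpow hA hθ
  refine ⟨A ^ θ / (A ^ θ - 1), div_pos (by positivity) (by linarith), fun L => ?_⟩
  have h2 : A ^ θ - 1 ≠ 0 := by linarith
  induction L with
  | zero => simpa using (div_pos (by positivity) (by linarith : 0 < A ^ θ - 1)).le
  | succ L ih =>
    rw [Finset.sum_Icc_succ_top (by omega)]
    have h3 : A ^ (θ * ((L + 1 : ℕ) : ℝ)) = A ^ (θ * L) * A ^ θ := by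
      rw [← Real.rpow_add hA0]; push_cast; ring_nf
    refine (add_le_add_left ih _).trans_eq ?_
    rw [h3]
    field_simp
    ring

theorem exists_sum_rpow_neg_le (hA : 1 < A) {θ : ℝ} (hθ : 0 < θ) : ∃ G : ℝ, 0 < G ∧
    ∀ L : ℕ, ∑ ℓ ∈ Finset.Icc 1 L, A ^ (-θ * ℓ) ≤ G := by
  have hA0 : 0 < A := by linarith
  have h1 : 1 < A ^ θ := Real.one_lt_rpow hA hθ
  have hG : 0 < (A ^ θ - 1)⁻¹ := inv_pos.2 (by linarith)
  refine ⟨(A ^ θ - 1)⁻¹, hG, fun L => ?_⟩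
  have h2 : A ^ θ - 1 ≠ 0 := by linarith
  have key : ∑ ℓ ∈ Finset.Icc 1 L, A ^ (-θ * ℓ) = (A ^ θ - 1)⁻¹ * (1 - A ^ (-θ * L)) := by
    induction L with
    | zero => simp
    | succ L ih =>
      rw [Finset.sum_Icc_succ_top (by omega), ih]
      have h3 : A ^ (-θ * L) = A ^ (-θ * ((L + 1 : ℕ) : ℝ)) * A ^ θ := by
        rw [← Real.rpow_add hA0]; push_cast; ring_nf
      rw [h3]
      field_simp
      ring
  rw [key]
  have : 0 < A ^ (-θ * L) := by positivity
  nlinarith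

/-- The number of levels needed for the bias. -/
theorem exists_level (hA : 1 < A) {α : ℝ} (hα : 0 < α) (a : ℝ) : ∃ D : ℝ, 1 ≤ D ∧
    ∀ ε : ℝ, 0 < ε → ε ≤ 1 / 2 → ∃ L : ℕ, 1 ≤ L ∧ a * A ^ (-α * L) ≤ ε / 3 ∧
      A ^ (α * L) ≤ D / ε := by
  have hA0 : 0 < A := by linarith
  have hB : 1 < A ^ α := Real.one_lt_rpow hA hα
  have hm : 1 ≤ max 1 (3 * a) := le_max_left _ _
  refine ⟨max 1 (3 * a) * A ^ α, by nlinarith, fun ε hε hε2 => ?_⟩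
  -- The threshold `max 1 (3 * a) / ε` lies between consecutive powers `n` and `n + 1` of `A^α`.
  -- Level `n + 1` passes it and overshoots by at most the factor `A^α` contained in `D`. The
  -- maximum with `1` keeps the threshold at least `1`, as the existence of `n` requires.
  obtain ⟨n, hn1, hn2⟩ := exists_nat_pow_near (x := max 1 (3 * a) / ε) (y := A ^ α)
    ((one_le_div hε).2 (by linarith)) hB
  have e : A ^ (α * ((n + 1 : ℕ) : ℝ)) = (A ^ α) ^ (n + 1) := by
    rw [Real.rpow_mul hA0.le, Real.rpow_natCast]
  refine ⟨n + 1, by omega, ?_, ?_⟩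
  · rw [neg_mul, Real.rpow_neg hA0.le, e, ← div_eq_mul_inv, div_le_iff₀ (by positivity)]
    have h1 : 3 * a / ε ≤ (A ^ α) ^ (n + 1) :=
      (div_le_div_of_nonneg_right (le_max_right 1 (3 * a)) hε.le).trans hn2.le
    rw [div_le_iff₀ hε] at h1
    linarith
  · rw [e, pow_succ, mul_div_right_comm]
    exact mul_le_mul_of_nonneg_right hn1 (by positivity)

/-- The numbers of samples per level. -/
theorem exists_samples (hA : 1 < A) {β γ b c ε : ℝ} (hb : 0 < b) (hc : 0 < c) (hε : 0 < ε)
    {L : ℕ} (hL : 1 ≤ L) : ∃ M : ℕ → ℕ, (∀ ℓ, 1 ≤ M ℓ) ∧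
    ∑ ℓ ∈ Finset.Icc 1 L, b * (√(M ℓ))⁻¹ * A ^ (-β * ℓ) ≤ ε / 3 ∧
    ∑ ℓ ∈ Finset.Icc 1 L, M ℓ * (c * A ^ (γ * ℓ))
      ≤ c * (9 * b ^ 2 * ((∑ ℓ ∈ Finset.Icc 1 L, A ^ ((γ / 2 - β) / 2 * ℓ)) ^ 2
          * ∑ ℓ ∈ Finset.Icc 1 L, A ^ ((γ / 2 - β) * ℓ)) * ε ^ (-2 : ℝ)
        + ∑ ℓ ∈ Finset.Icc 1 L, A ^ (γ * ℓ)) := by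
  have hA0 : 0 < A := by linarith
  set T := ∑ ℓ ∈ Finset.Icc 1 L, A ^ ((γ / 2 - β) / 2 * ℓ) with hT
  have hT0 : 0 < T := Finset.sum_pos (fun ℓ _ => by positivity) ⟨1, by simp [hL]⟩
  -- The factor `A^(-(β+γ/2)ℓ)` is the Lagrange choice for balancing variances `A^(-2βℓ) / M_ℓ`
  -- against costs `M_ℓ A^(γℓ)`. The prefactor normalises the sum of the level errors to `ε / 3`.
  set x : ℕ → ℝ := fun ℓ => (3 * b * T / ε * A ^ (-(β + γ / 2) / 2 * ℓ)) ^ 2 with hx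
  have hx0 : ∀ ℓ, 0 < x ℓ := fun ℓ => by positivity
  refine ⟨fun ℓ => ⌈x ℓ⌉₊, fun ℓ => Nat.ceil_pos.2 (hx0 ℓ), ?_, ?_⟩
  · calc ∑ ℓ ∈ Finset.Icc 1 L, b * (√(⌈x ℓ⌉₊ : ℝ))⁻¹ * A ^ (-β * ℓ)
        ≤ ∑ ℓ ∈ Finset.Icc 1 L, ε / (3 * T) * A ^ ((γ / 2 - β) / 2 * ℓ) := by
          refine Finset.sum_le_sum fun ℓ _ => ?_
          have h1 : 3 * b * T / ε * A ^ (-(β + γ / 2) / 2 * ℓ) ≤ √(⌈x ℓ⌉₊ : ℝ) :=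
            Real.le_sqrt_of_sq_le (Nat.le_ceil (x ℓ))
          have h2 : A ^ (-β * ℓ)
              = A ^ ((γ / 2 - β) / 2 * ℓ) * A ^ (-(β + γ / 2) / 2 * ℓ) := by
            rw [← Real.rpow_add hA0]; ring_nf
          calc b * (√(⌈x ℓ⌉₊ : ℝ))⁻¹ * A ^ (-β * ℓ)
              ≤ b * (3 * b * T / ε * A ^ (-(β + γ / 2) / 2 * ℓ))⁻¹ * A ^ (-β * ℓ) := by
                gcongr
            _ = _ := by rw [h2]; field_simp
      _ = ε / 3 := by rw [← Finset.mul_sum, ← hT]; field_simp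
  · calc ∑ ℓ ∈ Finset.Icc 1 L, (⌈x ℓ⌉₊ : ℝ) * (c * A ^ (γ * ℓ))
        ≤ ∑ ℓ ∈ Finset.Icc 1 L, (c * (9 * b ^ 2 * T ^ 2 * ε ^ (-2 : ℝ))
            * A ^ ((γ / 2 - β) * ℓ) + c * A ^ (γ * ℓ)) := by
          refine Finset.sum_le_sum fun ℓ _ => ?_
          -- Rounding up costs at most one extra sample per level; this is the separate sum of
          -- `A^(γℓ)`, the origin of `ε^(-γ/α)` in the final rate.
          have h1 : (⌈x ℓ⌉₊ : ℝ) ≤ x ℓ + 1 := (Nat.ceil_lt_add_one (hx0 ℓ).le).le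
          have h2 : (A ^ (-(β + γ / 2) / 2 * ℓ)) ^ 2 * A ^ (γ * ℓ) = A ^ ((γ / 2 - β) * ℓ) := by
            rw [← Real.rpow_natCast, ← Real.rpow_mul hA0.le, ← Real.rpow_add hA0]
            push_cast; ring_nf
          have h3 : ε ^ (-2 : ℝ) = (ε ^ 2)⁻¹ := by
            rw [Real.rpow_neg hε.le]; norm_num
          refine (mul_le_mul_of_nonneg_right h1 (by positivity)).trans_eq ?_
          rw [← h2, h3, hx]
          field_simp
          ring
      _ = _ := by
          rw [Finset.sum_add_distrib, ← Finset.mul_sum, ← Finset.mul_sum]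
          ring

/-- Converts growth in the level into a power of `1/ε`, by raising the bound on `A^(αL)` to the
power `κ / α`. It serves `κ = γ` and `κ = γ - 2β`. -/
theorem rpow_mul_level_le (hA : 1 < A) {α D ε κ : ℝ} (hα : 0 < α) (hD : 1 ≤ D) (hε : 0 < ε)
    (hκ : 0 ≤ κ) {L : ℕ} (hL : A ^ (α * L) ≤ D / ε) :
    A ^ (κ * L) ≤ D ^ (κ / α) * ε ^ (-(κ / α)) := by
  have hA0 : 0 < A := by linarith
  have h := Real.rpow_le_rpow (by positivity) hL (show 0 ≤ κ / α by positivity)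
  rw [← Real.rpow_mul hA0.le, Real.div_rpow (by linarith) hε.le] at h
  rw [Real.rpow_neg hε.le, ← div_eq_mul_inv]
  convert h using 2
  field_simp

/-- Taking logarithms bounds `αL` by `log_A D + |log_A ε|`; since `ε ≤ 1/2`, the second term is at
least `log_A 2 > 0` and absorbs the constant. -/
theorem exists_level_le_mul_abs_logb (hA : 1 < A) {α D : ℝ} (hα : 0 < α) (hD : 1 ≤ D) :
    ∃ H : ℝ, 0 < H ∧ ∀ ε : ℝ, 0 < ε → ε ≤ 1 / 2 → ∀ L : ℕ, A ^ (α * L) ≤ D / ε →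
      (L : ℝ) ≤ H * |Real.logb A ε| := by
  have hA0 : 0 < A := by linarith
  have hl2 : 0 < Real.logb A 2 := Real.logb_pos hA (by norm_num)
  have hlD : 0 ≤ Real.logb A D := Real.logb_nonneg hA hD
  refine ⟨(Real.logb A D / Real.logb A 2 + 1) / α, by positivity, fun ε hε hε2 L hL => ?_⟩
  have h1 : Real.logb A 2 ≤ |Real.logb A ε| := by
    have h2 : Real.logb A 2 ≤ -Real.logb A ε := by
      rw [← Real.logb_inv]
      refine Real.logb_le_logb_of_le hA (by norm_num) ?_
      rw [le_inv_comm₀ (by norm_num) hε]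
      linarith
    exact h2.trans (neg_le_abs _)
  have h3 : α * L ≤ Real.logb A D - Real.logb A ε := by
    rw [← Real.logb_div (by linarith) hε.ne', ← Real.logb_rpow hA0 hA.ne' (x := α * L)]
    exact Real.logb_le_logb_of_le hA (by positivity) hL
  have h4 : Real.logb A D ≤ Real.logb A D / Real.logb A 2 * |Real.logb A ε| := by
    rw [div_mul_eq_mul_div, le_div_iff₀ hl2]
    exact mul_le_mul_of_nonneg_left h1 hlD
  rw [div_mul_eq_mul_div, le_div_iff₀ hα]
  linarith [neg_le_abs (Real.logb A ε)]

/-- The sums with exponents `(γ/2 - β)/2` and `γ/2 - β` are bounded, equal to `L`, or dominated by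
their last term, according to the sign of `γ/2 - β`. In the last case the product is of order
`A^((γ-2β)L)`. -/
theorem exists_cost_le_complexityRate (hA : 1 < A) {α β γ D k : ℝ} (hα : 0 < α) (hγ : 0 < γ)
    (hD : 1 ≤ D) (hk : 0 < k) : ∃ C : ℝ, 0 < C ∧ ∀ ε : ℝ, 0 < ε → ε ≤ 1 / 2 → ∀ L : ℕ,
    A ^ (α * L) ≤ D / ε →
      k * ((∑ ℓ ∈ Finset.Icc 1 L, A ^ ((γ / 2 - β) / 2 * ℓ)) ^ 2
          * ∑ ℓ ∈ Finset.Icc 1 L, A ^ ((γ / 2 - β) * ℓ)) * ε ^ (-2 : ℝ)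
        + ∑ ℓ ∈ Finset.Icc 1 L, A ^ (γ * ℓ) ≤ C * complexityRate A α β γ ε := by
  have hA0 : 0 < A := by linarith
  have hnonneg : ∀ (θ : ℝ) (L : ℕ), 0 ≤ ∑ ℓ ∈ Finset.Icc 1 L, A ^ (θ * ℓ) := fun θ L =>
    Finset.sum_nonneg fun ℓ _ => by positivity
  obtain ⟨G, hG, hGle⟩ := exists_sum_rpow_le_mul_rpow hA hγ
  have hV : ∀ ε : ℝ, 0 < ε → ∀ L : ℕ, A ^ (α * L) ≤ D / ε →
      ∑ ℓ ∈ Finset.Icc 1 L, A ^ (γ * ℓ) ≤ G * D ^ (γ / α) * ε ^ (-(γ / α)) :=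
    fun ε hε L hL => by
      rw [mul_assoc]
      exact (hGle L).trans (mul_le_mul_of_nonneg_left
        (rpow_mul_level_le hA hα hD hε hγ.le hL) hG.le)
  set V := G * D ^ (γ / α) with hVdef
  have hV0 : 0 < V := by positivity
  -- the sampling part of the cost is at most a multiple of the second summand of the rate
  obtain ⟨R, W, hR0, hW0, hrate, hW⟩ : ∃ (R : ℝ → ℝ) (W : ℝ), (∀ ε, 0 < ε → 0 ≤ R ε) ∧ 0 < W ∧
      (∀ ε, complexityRate A α β γ ε = ε ^ (-(γ / α)) + R ε) ∧
      ∀ ε : ℝ, 0 < ε → ε ≤ 1 / 2 → ∀ L : ℕ, A ^ (α * L) ≤ D / ε →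
        ((∑ ℓ ∈ Finset.Icc 1 L, A ^ ((γ / 2 - β) / 2 * ℓ)) ^ 2
          * ∑ ℓ ∈ Finset.Icc 1 L, A ^ ((γ / 2 - β) * ℓ)) * ε ^ (-2 : ℝ) ≤ W * R ε := by
    rcases lt_trichotomy (γ / 2) β with h | h | h
    · obtain ⟨G₁, hG₁, hG₁le⟩ := exists_sum_rpow_neg_le hA (θ := (β - γ / 2) / 2) (by linarith)
      obtain ⟨G₂, hG₂, hG₂le⟩ := exists_sum_rpow_neg_le hA (θ := β - γ / 2) (by linarith)
      rw [show -((β - γ / 2) / 2) = (γ / 2 - β) / 2 by ring] at hG₁le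
      rw [neg_sub] at hG₂le
      refine ⟨fun ε => ε ^ (-2 : ℝ), G₁ ^ 2 * G₂, fun ε hε => by positivity, by positivity,
        fun ε => by simp only [complexityRate, if_pos h], fun ε hε _ L _ => ?_⟩
      have := hnonneg ((γ / 2 - β) / 2) L
      have := hnonneg (γ / 2 - β) L
      gcongr
      · exact hG₁le L
      · exact hG₂le L
    · obtain ⟨H, hH, hHle⟩ := exists_level_le_mul_abs_logb hA hα hD
      refine ⟨fun ε => ε ^ (-2 : ℝ) * |Real.logb A ε| ^ 3, H ^ 3, fun ε hε => by positivity,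
        by positivity, fun ε => ?_, fun ε hε hε2 L hL => ?_⟩
      · simp only [complexityRate]
        rw [if_neg (by rw [h]; exact lt_irrefl _), if_pos h.symm]
      · have h1 := pow_le_pow_left₀ (Nat.cast_nonneg L) (hHle ε hε hε2 L hL) 3
        have h2 := mul_le_mul_of_nonneg_right h1 (show 0 ≤ ε ^ (-2 : ℝ) by positivity)
        simp only [h, sub_self, zero_div, zero_mul, Real.rpow_zero, Finset.sum_const,
          Nat.card_Icc, nsmul_eq_mul, mul_one, add_tsub_cancel_right]
        calc ((L : ℝ) ^ 2 * L) * ε ^ (-2 : ℝ) = (L : ℝ) ^ 3 * ε ^ (-2 : ℝ) := by ring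
          _ ≤ _ := h2
          _ = _ := by ring
    · obtain ⟨G₁, hG₁, hG₁le⟩ := exists_sum_rpow_le_mul_rpow hA (θ := (γ / 2 - β) / 2)
        (by linarith)
      obtain ⟨G₂, hG₂, hG₂le⟩ := exists_sum_rpow_le_mul_rpow hA (θ := γ / 2 - β) (by linarith)
      refine ⟨fun ε => ε ^ (-2 - (γ - 2 * β) / α), G₁ ^ 2 * G₂ * D ^ ((γ - 2 * β) / α),
        fun ε hε => by positivity, by positivity, fun ε => ?_, fun ε hε _ L hL => ?_⟩
      · simp only [complexityRate]
        rw [if_neg (not_lt.2 h.le), if_neg h.ne]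
      · have h1 := rpow_mul_level_le hA hα hD hε (κ := γ - 2 * β) (by linarith) hL
        have h2 : (A ^ ((γ / 2 - β) / 2 * L)) ^ 2 * A ^ ((γ / 2 - β) * L)
            = A ^ ((γ - 2 * β) * L) := by
          rw [← Real.rpow_natCast, ← Real.rpow_mul hA0.le, ← Real.rpow_add hA0]
          push_cast; ring_nf
        have h3 : ε ^ (-2 - (γ - 2 * β) / α) = ε ^ (-((γ - 2 * β) / α)) * ε ^ (-2 : ℝ) := by
          rw [← Real.rpow_add hε]; ring_nf
        have := hnonneg ((γ / 2 - β) / 2) L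
        have := hnonneg (γ / 2 - β) L
        calc _ ≤ ((G₁ * A ^ ((γ / 2 - β) / 2 * L)) ^ 2 * (G₂ * A ^ ((γ / 2 - β) * L)))
              * ε ^ (-2 : ℝ) := by
              gcongr
              · exact hG₁le L
              · exact hG₂le L
          _ = G₁ ^ 2 * G₂ * ((A ^ ((γ / 2 - β) / 2 * L)) ^ 2 * A ^ ((γ / 2 - β) * L))
              * ε ^ (-2 : ℝ) := by ring
          _ ≤ G₁ ^ 2 * G₂ * (D ^ ((γ - 2 * β) / α) * ε ^ (-((γ - 2 * β) / α)))
              * ε ^ (-2 : ℝ) := by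
              rw [h2]
              gcongr
          _ = _ := by simp only [h3]; ring
  refine ⟨k * W + V, by positivity, fun ε hε hε2 L hL => ?_⟩
  have h1 := mul_le_mul_of_nonneg_left (hW ε hε hε2 L hL) hk.le
  have h2 := hV ε hε L hL
  have h3 := hR0 ε hε
  have h4 : 0 ≤ ε ^ (-(γ / α)) := by positivity
  have h5 : 0 ≤ k * W * ε ^ (-(γ / α)) := by positivity
  have h6 : 0 ≤ V * R ε := by positivity
  rw [hrate]
  calc _ ≤ k * (W * R ε) + V * ε ^ (-(γ / α)) := by
        rw [mul_assoc k]
        exact add_le_add h1 h2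
    _ ≤ _ := by linarith

/-- Choice of the number of levels and of the sample sizes. -/
theorem exists_parameters (hA : 1 < A) {α β γ a b c : ℝ} (hα : 0 < α) (hγ : 0 < γ)
    (hb : 0 < b) (hc : 0 < c) : ∃ C : ℝ, 0 < C ∧
    ∀ ε : ℝ, 0 < ε → ε ≤ 1 / 2 → ∃ (L : ℕ) (M : ℕ → ℕ), 1 ≤ L ∧ (∀ ℓ, 1 ≤ M ℓ) ∧
      a * A ^ (-α * L) + ∑ ℓ ∈ Finset.Icc 1 L, b * (√(M ℓ))⁻¹ * A ^ (-β * ℓ) < ε ∧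
      ∑ ℓ ∈ Finset.Icc 1 L, M ℓ * (c * A ^ (γ * ℓ)) ≤ C * complexityRate A α β γ ε := by
  obtain ⟨D, hD, hlevel⟩ := exists_level hA hα a
  obtain ⟨C, hC, hcost⟩ := exists_cost_le_complexityRate hA (β := β) hα hγ hD
    (show 0 < 9 * b ^ 2 by positivity)
  refine ⟨c * C, by positivity, fun ε hε hε2 => ?_⟩
  obtain ⟨L, hL1, hL2, hL3⟩ := hlevel ε hε hε2
  obtain ⟨M, hM1, hM2, hM3⟩ := exists_samples hA (β := β) (γ := γ) hb hc hε hL1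
  -- Bias and sampling error use `ε / 3` each; the unused third makes the inequality strict.
  refine ⟨L, M, hL1, hM1, by linarith, hM3.trans ?_⟩
  rw [mul_assoc c C]
  exact mul_le_mul_of_nonneg_left (hcost ε hε hε2 L hL3) hc.le

end Parameters

theorem rpow_neg_le_of_le {A c₁ x α : ℝ} (hA : 0 < A) (hc₁ : 0 < c₁) (hα : 0 ≤ α) {ℓ : ℕ}
    (h : c₁ * A ^ ℓ ≤ x) : x ^ (-α) ≤ c₁ ^ (-α) * A ^ (-α * ℓ) := by
  refine (Real.rpow_le_rpow_of_nonpos (by positivity) h (by linarith)).trans_eq ?_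
  rw [Real.mul_rpow hc₁.le (by positivity), ← Real.rpow_natCast A, ← Real.rpow_mul hA.le,
    mul_comm (ℓ : ℝ)]

theorem rpow_le_of_le {A c₂ x γ : ℝ} (hA : 0 < A) (hc₂ : 0 < c₂) (hγ : 0 ≤ γ) {ℓ : ℕ}
    (hx : 0 ≤ x) (h : x ≤ c₂ * A ^ ℓ) : x ^ γ ≤ c₂ ^ γ * A ^ (γ * ℓ) := by
  refine (Real.rpow_le_rpow hx h hγ).trans_eq ?_
  rw [Real.mul_rpow hc₂.le (by positivity), ← Real.rpow_natCast A, ← Real.rpow_mul hA.le,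
    mul_comm (ℓ : ℝ)]

end MLMC

/-! ### Error decomposition and conclusion -/

theorem MLMC.sub_estimator_eq {S Ω : Type*} [MeasurableSpace S] {μ : Measure S} {p : ℝ≥0∞}
    [Fact (1 ≤ p)] (x : Lp ℝ p μ) (m : ℕ → Lp ℝ p μ) (hm : m 0 = 0)
    (ξ : ℕ → ℕ → Ω → Lp ℝ p μ) (L : ℕ) (M : ℕ → ℕ) (ω : Ω) :
    x - MLMC.estimator ξ L M ω = (x - m L) + ∑ ℓ ∈ Finset.Icc 1 L,
      (m ℓ - m (ℓ - 1) - (M ℓ : ℝ)⁻¹ • ∑ j ∈ Finset.range (M ℓ), ξ ℓ j ω) := by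
  have htel : ∑ ℓ ∈ Finset.Icc 1 L, (m ℓ - m (ℓ - 1)) = m L := by
    induction L with
    | zero => simp [hm]
    | succ L ih => rw [Finset.sum_Icc_succ_top (by omega), ih]; simp
  rw [Finset.sum_sub_distrib, htel, MLMC.estimator]
  abel

universe u v

/-- The constant `C` depends only on `q`, the rates and the constants in the hypotheses. -/
theorem mainTheorem7 (q : ℝ≥0∞) [Fact (1 ≤ q)] (hq : 2 ≤ q) (hq_top : q ≠ ∞)
    (α β γ Cα Cβ Cγ A c₁ c₂ : ℝ) (hα : 0 < α) (hβ : 0 < β) (hγ : 0 < γ)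
    (hCα : 0 < Cα) (hCβ : 0 < Cβ) (hCγ : 0 < Cγ) (hA : 1 < A) (hc₁ : 0 < c₁) (hc₂ : 0 < c₂) :
    ∃ C : ℝ, 0 < C ∧
      ∀ (S : Type u) [MeasurableSpace S] (μ : Measure S) [SigmaFinite μ]
        (_ : MLMC.ApproxByAveraging.{u, v} μ)
        (Ω : Type v) [MeasurableSpace Ω] (P : Measure Ω) [IsProbabilityMeasure P]
        (p : ℝ≥0∞) [Fact (1 ≤ p)] (_ : p ≤ q)
        (X : Ω → Lp ℝ p μ) (_ : MemLp X 1 P)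
        -- the approximations, with the convention `X_0 = 0`
        (Xl : ℕ → Ω → Lp ℝ p μ) (_ : Xl 0 = 0)
        (_ : ∀ ℓ, 1 ≤ ℓ → MemLp (Xl ℓ) q P ∧ MLMC.MemMixed q P (Xl ℓ))
        (N : ℕ → ℝ) (_ : ∀ ℓ, 1 ≤ ℓ → c₁ * A ^ ℓ ≤ N ℓ ∧ N ℓ ≤ c₂ * A ^ ℓ)
        (cost : ℕ → ℝ≥0)
        -- the assumptions (α), (β), (γ)
        (_ : ∀ ℓ, 1 ≤ ℓ → ‖(∫ ω, X ω ∂P) - ∫ ω, Xl ℓ ω ∂P‖ ≤ Cα * N ℓ ^ (-α))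
        (_ : ∀ ℓ, 1 ≤ ℓ →
          MLMC.mixedNorm q P (fun ω => (Xl ℓ ω - ∫ ω', Xl ℓ ω' ∂P) -
            (Xl (ℓ - 1) ω - ∫ ω', Xl (ℓ - 1) ω' ∂P)) ≤ ENNReal.ofReal (Cβ * N ℓ ^ (-β)))
        (_ : ∀ ℓ, 1 ≤ ℓ → (cost ℓ : ℝ) ≤ Cγ * N ℓ ^ γ)
        -- on each level, a sequence of independent copies of `ξ_ℓ`
        (ξ : ℕ → ℕ → Ω → Lp ℝ p μ)
        (_ : ∀ ℓ, 1 ≤ ℓ → ∀ j, MemLp (ξ ℓ j) q P ∧ MLMC.MemMixed q P (ξ ℓ j))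
        (_ : ∀ ℓ, 1 ≤ ℓ → iIndepFun (ξ ℓ) P)
        (_ : ∀ ℓ, 1 ≤ ℓ → ∀ j, IdentDistrib (ξ ℓ j) (MLMC.levelDiff Xl ℓ) P P),
      ∀ ε : ℝ, 0 < ε → ε ≤ 1 / 2 →
        ∃ (L : ℕ) (M : ℕ → ℕ), 1 ≤ L ∧ (∀ ℓ ∈ Finset.Icc 1 L, 1 ≤ M ℓ) ∧
          eLpNorm (fun ω => (∫ ω', X ω' ∂P) - MLMC.estimator ξ L M ω) q P < ENNReal.ofReal ε ∧
          MLMC.totalCost cost L M ≤ C * MLMC.complexityRate A α β γ ε := by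
  have hA0 : 0 < A := by linarith
  have hq1 : 1 ≤ q := Fact.out
  obtain ⟨K, hK0, hK⟩ := MLMC.exists_eLpNorm_integral_sub_average_le.{u, v} hq hq_top
  -- The constants result from replacing `N_ℓ` by `A^ℓ`: negative powers use the lower bound with
  -- `c₁`, the cost uses the upper bound with `c₂`. The Monte Carlo constant `K` enters `b`.
  obtain ⟨C, hC0, hC⟩ := MLMC.exists_parameters hA (α := α) (β := β) (γ := γ)
    (a := Cα * c₁ ^ (-α)) (b := K * (Cβ * c₁ ^ (-β))) (c := Cγ * c₂ ^ γ) hα hγ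
    (by positivity) (by positivity)
  refine ⟨C, hC0, ?_⟩
  intro S _ μ _ _ Ω _ P _ p _ hpq X _ Xl hX0 hXl N hN cost hbias hvar hcost ξ hξ hind hid
    ε hε hε2
  obtain ⟨L, M, hL, hM, herr, hcst⟩ := hC ε hε hε2
  refine ⟨L, M, hL, fun ℓ _ => hM ℓ, ?_, ?_⟩
  -- Level `0` is included, since `ξ_1` involves `X_0`.
  · have hmem : ∀ ℓ, MemLp (Xl ℓ) q P := fun ℓ => by
      rcases Nat.eq_zero_or_pos ℓ with rfl | h
      · rw [hX0]; exact MemLp.zero'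
      · exact (hXl ℓ h).1
    have hint : ∀ ℓ, ∫ ω, MLMC.levelDiff Xl ℓ ω ∂P
        = ∫ ω, Xl ℓ ω ∂P - ∫ ω, Xl (ℓ - 1) ω ∂P := fun ℓ =>
      integral_sub ((hmem ℓ).integrable hq1) ((hmem (ℓ - 1)).integrable hq1)
    have hlevel : ∀ ℓ ∈ Finset.Icc 1 L, eLpNorm (fun ω => ∫ ω', Xl ℓ ω' ∂P
        - ∫ ω', Xl (ℓ - 1) ω' ∂P - (M ℓ : ℝ)⁻¹ • ∑ j ∈ Finset.range (M ℓ), ξ ℓ j ω) q P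
        ≤ ENNReal.ofReal (K * (Cβ * c₁ ^ (-β)) * (√(M ℓ))⁻¹ * A ^ (-β * ℓ)) := by
      intro ℓ hℓ
      have h1 : 1 ≤ ℓ := (Finset.mem_Icc.1 hℓ).1
      have h2 : MLMC.mixedNorm q P (fun ω => MLMC.levelDiff Xl ℓ ω
          - ∫ ω', MLMC.levelDiff Xl ℓ ω' ∂P) ≤ ENNReal.ofReal (Cβ * N ℓ ^ (-β)) := by
        convert hvar ℓ h1 using 3 with ω
        rw [hint, MLMC.levelDiff]
        abel
      have h3 := hK hpq (η := MLMC.levelDiff Xl ℓ) ((hmem ℓ).sub (hmem (ℓ - 1))) h2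
        (fun j => (hξ ℓ h1 j).1) (hind ℓ h1) (hid ℓ h1) (M ℓ) (hM ℓ)
      rw [hint] at h3
      refine h3.trans (ENNReal.ofReal_le_ofReal ?_)
      have h4 := MLMC.rpow_neg_le_of_le hA0 hc₁ hβ.le (hN ℓ h1).1
      calc K * (√(M ℓ))⁻¹ * (Cβ * N ℓ ^ (-β))
          ≤ K * (√(M ℓ))⁻¹ * (Cβ * (c₁ ^ (-β) * A ^ (-β * ℓ))) := by gcongr
        _ = _ := by ring
    simp only [MLMC.sub_estimator_eq _ (fun ℓ => ∫ ω, Xl ℓ ω ∂P) (by simp [hX0])]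
    have hmeas : ∀ ℓ ∈ Finset.Icc 1 L, AEStronglyMeasurable (fun ω => ∫ ω', Xl ℓ ω' ∂P
        - ∫ ω', Xl (ℓ - 1) ω' ∂P - (M ℓ : ℝ)⁻¹ • ∑ j ∈ Finset.range (M ℓ), ξ ℓ j ω) P :=
      fun ℓ hℓ => aestronglyMeasurable_const.sub (AEStronglyMeasurable.fun_const_smul
        (Finset.aestronglyMeasurable_fun_sum _ fun j _ =>
          (hξ ℓ (Finset.mem_Icc.1 hℓ).1 j).1.1) _)
    have hbias' : ‖(∫ ω, X ω ∂P) - ∫ ω, Xl L ω ∂P‖ ≤ Cα * c₁ ^ (-α) * A ^ (-α * L) := by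
      refine (hbias L hL).trans ?_
      rw [mul_assoc]
      exact mul_le_mul_of_nonneg_left
        (MLMC.rpow_neg_le_of_le hA0 hc₁ hα.le (hN L hL).1) hCα.le
    refine lt_of_le_of_lt ?_ ((ENNReal.ofReal_lt_ofReal_iff hε).2 herr)
    rw [ENNReal.ofReal_add (by positivity) (Finset.sum_nonneg fun ℓ _ => by positivity),
      ENNReal.ofReal_sum_of_nonneg fun ℓ _ => by positivity]
    -- Only the triangle inequality links the levels, so no independence between them enters.
    refine (eLpNorm_add_le aestronglyMeasurable_const
      (Finset.aestronglyMeasurable_fun_sum _ hmeas) hq1).trans (add_le_add ?_ ?_)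
    · rw [eLpNorm_const _ (zero_lt_one.trans_le hq1).ne' (IsProbabilityMeasure.ne_zero P)]
      simp only [measure_univ, ENNReal.one_rpow, mul_one]
      rw [← ofReal_norm]
      exact ENNReal.ofReal_le_ofReal hbias'
    · have h1 := eLpNorm_sum_le hmeas hq1
      rw [Finset.sum_fn] at h1
      exact h1.trans (Finset.sum_le_sum hlevel)
  · refine le_trans (Finset.sum_le_sum fun ℓ hℓ => ?_) hcst
    have h1 : 1 ≤ ℓ := (Finset.mem_Icc.1 hℓ).1
    refine mul_le_mul_of_nonneg_left ((hcost ℓ h1).trans ?_) (Nat.cast_nonneg _)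
    rw [mul_assoc]
    exact mul_le_mul_of_nonneg_left (MLMC.rpow_le_of_le hA0 hc₂ hγ.le
      (le_trans (by positivity) (hN ℓ h1).1) (hN ℓ h1).2) hCγ.le
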